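/- For a complex $a\times n$ matrix $A$, the squared singular values of $A$ are the $n$ eigenvalues of $A^*A$, counted with multiplicity. Write $\Delta_n(x)=\prod_{1\le j<k\le n}(x_k-x_j)$. Random points $x_1,\dots,x_n$ are said to be a polynomial ensemble with real-valued functions $f_1,\dots,f_n$ on $(0,\infty)$ if the integrals $\int_0^\infty x^{j-1}f_k(x)\,dx$ $(1\le j,k\le n)$ converge absolutely and, for some constant $Z\neq 0$, the function $$\frac1Z\,\Delta_n(x)\,\det\left[f_k(x_j)\right]_{j,k=1}^n$$ is non-negative on $(0,\infty)^n$ and is the joint probability density on $(0,\infty)^n$ of the unordered points $x_1,\dots,x_n$, i.e. $\mathbb E\,F(x_1,\dots,x_n)=\frac1Z\int_{(0,\infty)^n}F(x)\,\Delta_n(x)\det[f_k(x_j)]\,dx$ for every symmetric Borel function $F\ge 0$. **Theorem.** Let $n,m,l,\nu$ be non-negative integers with $n\le l\le m$ and $m\ge n+\nu+1$. Let $U$ be a Haar distributed random unitary matrix of size $m\times m$, and let $T$ be an $(n+\nu)\times l$ truncation of $U$, i.e. the submatrix of $U$ formed by $n+\nu$ fixed rows and $l$ fixed columns (for example its upper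 left block). Let $X$ be a random complex matrix of size $l\times n$, independent of $U$, such that the squared singular values of $X$ are a polynomial ensemble with functions $f_1,\dots,f_n$. Then for every $k$ and every $y>0$ the integral $$g_k(y)=\int_0^1 x^{\nu}(1-x)^{m-n-\nu-1}f_k\!\left(\frac yx\right)\frac{dx}{x}$$ converges absolutely, and the squared singular values $y_1,\dots,y_n$ of $Y=TX$ are a polynomial ensemble with functions $g_1,\dots,g_n$; that is, for some constant $\tilde Z_n\neq 0$ their joint probability density is $$\frac1{\tilde Z_n}\,\Delta_n(y)\,\det\left[g_k(y_j)\right]_{j,k=1}^n,\qquad\text{all } y_j>0 .$$ -/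

import Mathlib

open MeasureTheory ProbabilityTheory
open scoped Matrix

/-- Matrices carry the product sigma-algebra of their entries: a random matrix is measurable
iff all its entries are. -/
instance matrixMeasurableSpace {ι κ α : Type*} [MeasurableSpace α] :
    MeasurableSpace (Matrix ι κ α) :=
  inferInstanceAs (MeasurableSpace (ι → κ → α))

/-- The product sigma-algebra on matrices is the Borel sigma-algebra of the usual topology, so that
Mathlib's Haar measures on the unitary group are Borel measures for it. -/
instance matrixBorelSpace {ι κ : Type*} [Countable ι] [Countable κ] :
    BorelSpace (Matrix ι κ ℂ) :=
  inferInstanceAs (BorelSpace (ι → κ → ℂ))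

/-- The squared singular values of a complex `a × n` matrix `A`: the `n` eigenvalues of `A* A`,
counted with multiplicity (the labelling by `Fin n` carries no meaning). -/
noncomputable def sqSingularValues {a n : ℕ} (A : Matrix (Fin a) (Fin n) ℂ) : Fin n → ℝ :=
  (Matrix.isHermitian_conjTranspose_mul_self A).eigenvalues

/-- The function `Δ_n(x) det [f_k(x_j)]`, with `Δ_n(x) = ∏_{j<k} (x_k - x_j)`. -/
noncomputable def vandermondeTimesDet {n : ℕ} (f : Fin n → ℝ → ℝ) (x : Fin n → ℝ) : ℝ :=
  (∏ j : Fin n, ∏ k ∈ Finset.Ioi j, (x k - x j)) *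
    (Matrix.of fun j k : Fin n => f k (x j)).det

/-- The unlabelled random points `z_1, …, z_n` have the symmetric function `p` as their joint
density on `(0,∞)^n`: `𝔼 F(z) = ∫ F(x) p(x) dx` for every nonnegative Borel function `F`
that is invariant under permutations of the coordinates. -/
def HasUnorderedDensity {Ω : Type*} [MeasurableSpace Ω] (P : Measure Ω) {n : ℕ}
    (z : Ω → Fin n → ℝ) (p : (Fin n → ℝ) → ℝ) : Prop :=
  ∀ F : (Fin n → ℝ) → ENNReal, Measurable F →
    (∀ (σ : Equiv.Perm (Fin n)) (x : Fin n → ℝ), F (fun i => x (σ i)) = F x) →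
    ∫⁻ ω, F (z ω) ∂P =
      ∫⁻ x in {x : Fin n → ℝ | ∀ j, 0 < x j}, F x * ENNReal.ofReal (p x)

/-- The random points `z_1, …, z_n` are a polynomial ensemble on `(0,∞)` with the functions
`f_1, …, f_n` (only the values of `f_k` on `(0,∞)` matter): the integrals `∫ x^(j-1) f_k(x) dx`
converge, and for some constant `Z` the function `Z⁻¹ Δ_n(x) det [f_k(x_j)]` is nonnegative and
is the joint density of the points. -/
structure IsPolynomialEnsemble {Ω : Type*} [MeasurableSpace Ω] (P : Measure Ω) {n : ℕ}
    (z : Ω → Fin n → ℝ) (f : Fin n → ℝ → ℝ) : Prop where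
  integrable_moments : ∀ j k : Fin n,
    IntegrableOn (fun x : ℝ => x ^ (j : ℕ) * f k x) (Set.Ioi 0)
  exists_density : ∃ Z : ℝ, Z ≠ 0 ∧
    (∀ x : Fin n → ℝ, (∀ j, 0 < x j) → 0 ≤ Z⁻¹ * vandermondeTimesDet f x) ∧
    HasUnorderedDensity P z (fun x => Z⁻¹ * vandermondeTimesDet f x)

/-! Up to a permutation of its rows, `U` has `T` in its first `n + ν` rows. Let `B` consist of all
`m` rows of the `l` chosen columns of `U`, rows permuted accordingly, multiplied by `X`. Those
columns are orthonormal, so `B` has the squared singular values of `X`, and the law of `B` is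
invariant under left multiplication by unitaries because `U` is Haar distributed and independent of
`X`. The product `TX` arises from `B` by deleting its last `m - n - ν` rows, which is done one row
at a time.

Deleting one row from an invariant `B` with `n + ν + 1` rows replaces `B*B` by `B*(1 - u*u)B`, with
`u` a coordinate row. By invariance `u` may be averaged over all directions
(`lintegral_deflatedGram_single`). In a singular value basis of `B` the new matrix is `diag(x)`
minus a rank-one term, and its eigenvalues `y` solve a secular equation whose weights `w_k` are
squared moduli of the first `n` coordinates of a uniform direction in `ℂ^(n+ν+1)`. These weights
have a Dirichlet law, with density proportional to `(1 - ∑ w_k)^ν` on the simplex. The map from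
weights to roots is a bijection onto the points `y_1 < x_1 < y_2 < ⋯ < y_n < x_n`, and its Jacobian
is a quotient of Vandermonde products. Given `x`, the points `y` therefore have density proportional
to `∏ y_k^ν Δ(y) / (∏ x_k^(ν+1) Δ(x))` (`exists_lintegral_deflatedGram_eq`).

Against the density `Δ(x) det[f_k(x_j)]` the factor `Δ(x)` cancels. For fixed `y` the interlacing
`x` fill a box, so the determinant integrates entry by entry over the gaps between the `y_j`, and a
unitriangular row operation turns gaps into half-lines. The outcome is again a polynomial ensemble,
with `f_k` replaced by `y^ν ∫_y^∞ t^(-ν-1) f_k(t) dt` (`lintegral_interlacingAverage`,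
`IsPolynomialEnsemble.deleteLastRow`).

Iterating, the one-row kernels compose to the kernel with `(t - y)^p`, up to a constant
(`truncationTransform_comp`), and `x = y / t` turns this into the stated integral over `(0,1)`.
Normalising constants are never evaluated: only that they are finite and nonzero matters. -/

/-! ### Eigenvalues as multisets, and their measurability -/

theorem exists_perm_of_map_univ_eq {ι α : Type*} [Fintype ι] {f g : ι → α}
    (h : Finset.univ.val.map f = Finset.univ.val.map g) : ∃ σ : Equiv.Perm ι, f ∘ σ = g := by
  classical
  have hc : ∀ c, Fintype.card {i // g i = c} = Fintype.card {i // f i = c} := by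
    intro c
    have := congrArg (Multiset.count c) h
    rw [Multiset.count_map, Multiset.count_map] at this
    rw [Fintype.card_subtype, Fintype.card_subtype, Finset.card_def, Finset.card_def,
      Finset.filter_val, Finset.filter_val]
    simp only [eq_comm (b := c)] at this ⊢
    exact this.symm
  refine ⟨Equiv.ofFiberEquiv (f := g) (g := f) fun c => Fintype.equivOfCardEq (hc c), ?_⟩
  funext i
  exact Equiv.ofFiberEquiv_map _ i

theorem exists_perm_eigenvalues_of_charpoly_eq {n : ℕ} {H : Matrix (Fin n) (Fin n) ℂ}
    (hH : H.IsHermitian) {y : Fin n → ℝ}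
    (h : H.charpoly = ∏ i, (Polynomial.X - Polynomial.C (y i : ℂ))) :
    ∃ σ : Equiv.Perm (Fin n), y ∘ σ = hH.eigenvalues := by
  apply exists_perm_of_map_univ_eq
  have h1 := hH.roots_charpoly_eq_eigenvalues
  rw [h, Polynomial.roots_prod _ _
    (by simp [Finset.prod_ne_zero_iff, Polynomial.X_sub_C_ne_zero])] at h1
  have h2 : Multiset.map (fun i => (y i : ℂ)) Finset.univ.val
      = Multiset.map (RCLike.ofReal ∘ hH.eigenvalues) Finset.univ.val := by
    simpa using h1
  have h3 := congrArg (Multiset.map Complex.re) h2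
  simpa [Multiset.map_map, Function.comp_def] using h3

theorem trace_pow_eq_sum_eigenvalues_pow {n : ℕ} {H : Matrix (Fin n) (Fin n) ℂ}
    (hH : H.IsHermitian) (k : ℕ) :
    (H ^ k).trace = ∑ i, (hH.eigenvalues i : ℂ) ^ k := by
  conv_lhs => rw [hH.spectral_theorem, ← map_pow, Matrix.diagonal_pow]
  rw [Unitary.conjStarAlgAut_apply, Matrix.trace_mul_comm, ← mul_assoc]
  simp [Matrix.trace]

/-- The ramps `min 1 (max 0 (j (x - t)))` steepen to the indicator, and Weierstrass approximates the
`j`-th one on `[-j, j]` within `1 / (j + 1)`. This lets power sums control the number of coordinates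
above `t`. -/
theorem exists_polynomial_tendsto_indicator_Ioi (t : ℝ) :
    ∃ p : ℕ → Polynomial ℝ, ∀ x, Filter.Tendsto (fun j => (p j).eval x) Filter.atTop
      (nhds ((Set.Ioi t).indicator 1 x)) := by
  let φ : ℕ → ℝ → ℝ := fun j x => min 1 (max 0 (j * (x - t)))
  have hφ : ∀ j, Continuous (φ j) := by intro j; fun_prop
  choose p hp using fun j : ℕ => exists_polynomial_near_of_continuousOn (-(j : ℝ)) j (φ j)
    (hφ j).continuousOn (1 / ((j : ℝ) + 1)) (by positivity)
  refine ⟨p, fun x => ?_⟩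
  have h1 : Filter.Tendsto (fun j => φ j x) Filter.atTop (nhds ((Set.Ioi t).indicator 1 x)) := by
    by_cases hx : t < x
    · rw [Set.indicator_of_mem (by exact hx)]
      apply tendsto_const_nhds.congr'
      obtain ⟨N, hN⟩ := exists_nat_gt (1 / (x - t))
      filter_upwards [Filter.eventually_ge_atTop N] with j hj
      have hxt : 0 < x - t := by linarith
      have : 1 ≤ (j : ℝ) * (x - t) := by
        rw [← div_le_iff₀ hxt]
        exact hN.le.trans (by exact_mod_cast hj)
      simp only [φ, Pi.one_apply]
      rw [max_eq_right (by linarith), min_eq_left this]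
    · rw [Set.indicator_of_notMem (by exact hx)]
      apply tendsto_const_nhds.congr
      intro j
      have : (j : ℝ) * (x - t) ≤ 0 :=
        mul_nonpos_of_nonneg_of_nonpos (by positivity) (by linarith)
      simp [φ, max_eq_left this]
  have h2 : Filter.Tendsto (fun j => (p j).eval x - φ j x) Filter.atTop (nhds 0) := by
    apply squeeze_zero_norm' _ tendsto_one_div_add_atTop_nhds_zero_nat
    obtain ⟨N, hN⟩ := exists_nat_gt |x|
    filter_upwards [Filter.eventually_ge_atTop N] with j hj
    have : |x| ≤ j := hN.le.trans (by exact_mod_cast hj)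
    exact (hp j x (abs_le.mp this)).le
  simpa using h2.add h1

/-- For decreasing coordinates, the one with index `i` (from zero) exceeds `t` exactly when more
than `i` coordinates do, and that count is a pointwise limit of linear combinations of power sums.
-/
theorem measurable_of_antitone_of_power_sums {α : Type*} [MeasurableSpace α] {n : ℕ}
    {v : α → Fin n → ℝ} (hv : ∀ a, Antitone (v a))
    (hs : ∀ k : ℕ, Measurable fun a => ∑ i, v a i ^ k) : Measurable v := by
  have hN : ∀ t, Measurable fun a => ∑ i, (Set.Ioi t).indicator (1 : ℝ → ℝ) (v a i) := by
    intro t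
    obtain ⟨p, hp⟩ := exists_polynomial_tendsto_indicator_Ioi t
    refine measurable_of_tendsto_metrizable (f := fun j a => ∑ i, (p j).eval (v a i)) ?_ ?_
    · intro j
      simp_rw [Polynomial.eval_eq_sum_range]
      simp_rw [Finset.sum_comm (s := Finset.univ), ← Finset.mul_sum]
      exact Finset.measurable_sum _ fun k _ => (hs k).const_mul _
    · rw [tendsto_pi_nhds]
      intro a
      exact tendsto_finsetSum _ fun i _ => hp _
  have hN' : ∀ t a, ∑ i, (Set.Ioi t).indicator (1 : ℝ → ℝ) (v a i)
      = ((Finset.univ.filter fun i => t < v a i).card : ℝ) := by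
    intro t a
    simp [Set.indicator_apply]
  rw [measurable_pi_iff]
  intro i
  apply measurable_of_Ioi
  intro t
  have : (fun a => v a i) ⁻¹' Set.Ioi t
      = {a | (i : ℝ) < ∑ i, (Set.Ioi t).indicator (1 : ℝ → ℝ) (v a i)} := by
    ext a
    simp only [Set.mem_preimage, Set.mem_Ioi, Set.mem_ofPred_eq, hN', Nat.cast_lt]
    constructor
    · intro h
      have : Finset.Iic i ⊆ Finset.univ.filter fun i => t < v a i := by
        intro j hj
        simp only [Finset.mem_filter, Finset.mem_univ, true_and]
        exact h.trans_le (hv a (Finset.mem_Iic.mp hj))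
      have := Finset.card_le_card this
      rw [Fin.card_Iic] at this
      omega
    · intro h
      by_contra hc
      have : (Finset.univ.filter fun i => t < v a i) ⊆ Finset.Iio i := by
        intro j hj
        simp only [Finset.mem_filter, Finset.mem_univ, true_and] at hj
        rw [Finset.mem_Iio]
        by_contra hji
        exact hc (hj.trans_le (hv a (not_lt.mp hji)))
      have := Finset.card_le_card this
      rw [Fin.card_Iio] at this
      omega
  rw [this]
  exact measurableSet_lt measurable_const (hN t)

/-- Power sums of eigenvalues are traces of powers, hence continuous in the matrix; `eigenvalues₀`
is the decreasing enumeration to which the previous criterion applies. -/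
theorem measurable_eigenvalues {α : Type*} [MeasurableSpace α] {n : ℕ}
    {H : α → Matrix (Fin n) (Fin n) ℂ} (hH : ∀ a, (H a).IsHermitian) (hm : Measurable H) :
    Measurable fun a => (hH a).eigenvalues := by
  have h0 : Measurable fun a => (hH a).eigenvalues₀ := by
    refine measurable_of_antitone_of_power_sums (fun a => (hH a).eigenvalues₀_antitone) fun k => ?_
    have : ∀ a, ∑ i, (hH a).eigenvalues₀ i ^ k = ((H a) ^ k).trace.re := by
      intro a
      rw [trace_pow_eq_sum_eigenvalues_pow (hH a) k, Complex.re_sum]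
      simp only [← Complex.ofReal_pow, Complex.ofReal_re, Matrix.IsHermitian.eigenvalues]
      exact (Equiv.sum_comp (Fintype.equivOfCardEq (Fintype.card_fin _)).symm
        fun i => (hH a).eigenvalues₀ i ^ k).symm
    simp_rw [this]
    have hc : Continuous fun M : Matrix (Fin n) (Fin n) ℂ => (M ^ k).trace.re := by
      fun_prop
    exact hc.measurable.comp hm
  rw [measurable_pi_iff] at h0 ⊢
  exact fun i => h0 _

/-! ### Symmetric functions and the ordered chamber -/

/-- The strictly increasing points with positive coordinates. -/
def chamber (n : ℕ) : Set (Fin n → ℝ) := {x | StrictMono x ∧ ∀ j, 0 < x j}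

/-- The symmetric function that agrees with `K` on the chamber and vanishes at the points that
have no rearrangement there. -/
noncomputable def symmetrize {n : ℕ} (K : (Fin n → ℝ) → ENNReal) (x : Fin n → ℝ) : ENNReal :=
  ∑ σ : Equiv.Perm (Fin n), (chamber n).indicator K (x ∘ σ)

theorem measurableSet_chamber (n : ℕ) : MeasurableSet (chamber n) := by
  have : chamber n = (⋂ i : Fin n, ⋂ j : Fin n, {x | i < j → x i < x j}) ∩ ⋂ j : Fin n,
      {x | 0 < x j} := by
    ext x
    simp [chamber, StrictMono]
  rw [this]
  refine MeasurableSet.inter (MeasurableSet.iInter fun i => MeasurableSet.iInter fun j => ?_)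
    (MeasurableSet.iInter fun j => measurableSet_lt measurable_const (measurable_pi_apply j))
  by_cases h : i < j
  · simpa [h] using measurableSet_lt (measurable_pi_apply i) (measurable_pi_apply j)
  · simp [h]

theorem measurable_comp_perm {n : ℕ} (σ : Equiv.Perm (Fin n)) :
    Measurable fun x : Fin n → ℝ => x ∘ σ :=
  measurable_pi_iff.mpr fun i => measurable_pi_apply (σ i)

theorem perm_eq_of_comp_mem_chamber {n : ℕ} {x : Fin n → ℝ} {σ τ : Equiv.Perm (Fin n)}
    (hσ : x ∘ σ ∈ chamber n) (hτ : x ∘ τ ∈ chamber n) : σ = τ := by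
  have h : (x ∘ σ : Fin n → ℝ) = x ∘ τ := by
    rw [Tuple.comp_sort_eq_comp_iff_monotone.mpr hσ.1.monotone,
      Tuple.comp_sort_eq_comp_iff_monotone.mpr hτ.1.monotone]
  have hinj : Function.Injective x := by
    have := hσ.1.injective.comp σ.symm.injective
    simpa [Function.comp_assoc] using this
  ext i
  exact congrArg Fin.val (hinj (congrFun h i))

theorem symmetrize_of_mem {n : ℕ} (K : (Fin n → ℝ) → ENNReal) {x : Fin n → ℝ}
    {σ : Equiv.Perm (Fin n)} (hσ : x ∘ σ ∈ chamber n) : symmetrize K x = K (x ∘ σ) := by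
  rw [symmetrize, Finset.sum_eq_single σ, Set.indicator_of_mem hσ]
  · intro τ _ h
    exact Set.indicator_of_notMem (fun hτ => h (perm_eq_of_comp_mem_chamber hτ hσ)) _
  · simp

theorem symmetrize_comp_perm {n : ℕ} (K : (Fin n → ℝ) → ENNReal) (τ : Equiv.Perm (Fin n))
    (x : Fin n → ℝ) : symmetrize K (fun i => x (τ i)) = symmetrize K x := by
  rw [symmetrize, symmetrize,
    ← Equiv.sum_comp (Equiv.mulLeft τ) fun σ => (chamber n).indicator K (x ∘ σ)]
  rfl

theorem measurable_symmetrize {n : ℕ} {K : (Fin n → ℝ) → ENNReal} (hK : Measurable K) :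
    Measurable (symmetrize K) :=
  Finset.measurable_sum _ fun σ _ =>
    (hK.indicator (measurableSet_chamber n)).comp (measurable_comp_perm σ)

/-- Two coordinates coincide only on a proper linear subspace, and there are finitely many pairs. -/
theorem ae_injective_pi (n : ℕ) : ∀ᵐ x : Fin n → ℝ ∂volume, Function.Injective x := by
  have : ∀ᵐ x : Fin n → ℝ ∂volume, ∀ i j : Fin n, i ≠ j → x i ≠ x j := by
    rw [ae_all_iff]; intro i
    rw [ae_all_iff]; intro j
    by_cases h : i = j
    · simp [h]
    classical
    let L : (Fin n → ℝ) →ₗ[ℝ] ℝ := LinearMap.proj (R := ℝ) (φ := fun _ => ℝ) i - LinearMap.proj (R := ℝ) (φ := fun _ => ℝ) j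
    have h0 : volume (LinearMap.ker L : Set (Fin n → ℝ)) = 0 := by
      apply Measure.addHaar_submodule
      intro hT
      rw [LinearMap.ker_eq_top] at hT
      have := LinearMap.congr_fun hT (Pi.single i 1)
      simp [L, Ne.symm h] at this
    rw [ae_iff]
    convert h0 using 2
    ext x
    simp [L, h, sub_eq_zero]
  filter_upwards [this] with x hx i j h
  by_contra hij
  exact hx i j hij h

theorem exists_perm_comp_mem_chamber {n : ℕ} {x : Fin n → ℝ} (hx : Function.Injective x)
    (h0 : ∀ j, 0 < x j) : ∃ σ : Equiv.Perm (Fin n), x ∘ σ ∈ chamber n :=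
  ⟨Tuple.sort x, (Tuple.monotone_sort x).strictMono_of_injective
    (hx.comp (Tuple.sort x).injective), fun _ => h0 _⟩

/-- Up to a null set the positive orthant is the disjoint union of the `n!` rearranged chambers, and
permuting coordinates preserves volume. -/
theorem lintegral_pos_eq_factorial_mul {n : ℕ} {φ : (Fin n → ℝ) → ENNReal}
    (hφ : ∀ (σ : Equiv.Perm (Fin n)) (x : Fin n → ℝ), (∀ j, 0 < x j) → φ (x ∘ σ) = φ x) :
    ∫⁻ x in {x : Fin n → ℝ | ∀ j, 0 < x j}, φ x = n.factorial * ∫⁻ x in chamber n, φ x := by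
  have hset : {x : Fin n → ℝ | ∀ j, 0 < x j} =ᵐ[volume]
      ⋃ σ : Equiv.Perm (Fin n), {x : Fin n → ℝ | x ∘ σ ∈ chamber n} := by
    rw [Filter.eventuallyEq_set]
    filter_upwards [ae_injective_pi n] with x hx
    simp only [Set.mem_iUnion]
    refine ⟨fun h => exists_perm_comp_mem_chamber hx h, ?_⟩
    rintro ⟨σ, hσ⟩ j
    simpa using hσ.2 (σ.symm j)
  rw [setLIntegral_congr hset, lintegral_iUnion, tsum_fintype]
  · have : ∀ σ : Equiv.Perm (Fin n), ∫⁻ x in {x : Fin n → ℝ | x ∘ σ ∈ chamber n}, φ x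
        = ∫⁻ x in chamber n, φ x := by
      intro σ
      have hmp := volume_preserving_arrowCongr' σ.symm (MeasurableEquiv.refl ℝ)
        (MeasurePreserving.id _)
      have he : ∀ x : Fin n → ℝ, MeasurableEquiv.arrowCongr' σ.symm (MeasurableEquiv.refl ℝ) x
          = x ∘ σ := fun x => rfl
      have h1 := hmp.setLIntegral_comp_emb (MeasurableEquiv.measurableEmbedding _) φ
        ({x : Fin n → ℝ | x ∘ σ ∈ chamber n})
      have h2 := hmp.setLIntegral_comp_preimage_emb (MeasurableEquiv.measurableEmbedding _) φ
        (chamber n)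
      rw [← h2]
      refine setLIntegral_congr_fun
        ((measurable_comp_perm σ) (measurableSet_chamber n)) fun x hx => ?_
      rw [he]
      refine (hφ σ x fun j => ?_).symm
      simpa using hx.2 (σ.symm j)
    simp [this, Fintype.card_perm]
  · exact fun σ => measurable_comp_perm σ (measurableSet_chamber n)
  · intro σ τ h
    refine Set.disjoint_left.mpr fun x hσ hτ => h (perm_eq_of_comp_mem_chamber hσ hτ)

theorem prod_Ioi_sub_comp_perm {n : ℕ} (σ : Equiv.Perm (Fin n)) (x : Fin n → ℝ) :
    ∏ j : Fin n, ∏ k ∈ Finset.Ioi j, ((x ∘ σ) k - (x ∘ σ) j)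
      = ((Equiv.Perm.sign σ : ℤ) : ℝ) * ∏ j : Fin n, ∏ k ∈ Finset.Ioi j, (x k - x j) := by
  rw [← Matrix.det_vandermonde, ← Matrix.det_vandermonde, ← Matrix.det_permute]
  rfl

theorem vandermondeTimesDet_comp_perm {n : ℕ} (f : Fin n → ℝ → ℝ) (σ : Equiv.Perm (Fin n))
    (x : Fin n → ℝ) : vandermondeTimesDet f (x ∘ σ) = vandermondeTimesDet f x := by
  have h : (Matrix.of fun j k : Fin n => f k ((x ∘ σ) j)).det
      = ((Equiv.Perm.sign σ : ℤ) : ℝ) * (Matrix.of fun j k : Fin n => f k (x j)).det := by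
    rw [← Matrix.det_permute]
    rfl
  rw [vandermondeTimesDet, vandermondeTimesDet, prod_Ioi_sub_comp_perm, h, mul_mul_mul_comm,
    ← Int.cast_mul]
  simp [← Units.val_mul]

theorem vandermonde_pos {n : ℕ} {x : Fin n → ℝ} (hx : StrictMono x) :
    0 < ∏ j : Fin n, ∏ k ∈ Finset.Ioi j, (x k - x j) :=
  Finset.prod_pos fun _ _ => Finset.prod_pos fun _ hk => sub_pos.mpr (hx (Finset.mem_Ioi.mp hk))

theorem vandermondeTimesDet_of_not_injective {n : ℕ} (f : Fin n → ℝ → ℝ) {x : Fin n → ℝ}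
    (hx : ¬ Function.Injective x) : vandermondeTimesDet f x = 0 := by
  rw [vandermondeTimesDet, ← Matrix.det_vandermonde]
  have := mt Matrix.det_vandermonde_ne_zero_iff.mp hx
  rw [not_not.mp this, zero_mul]

theorem HasUnorderedDensity.lintegral_eq {Ω : Type*} [MeasurableSpace Ω] {P : Measure Ω} {n : ℕ}
    {z : Ω → Fin n → ℝ} {p : (Fin n → ℝ) → ℝ} (h : HasUnorderedDensity P z p)
    (hp : ∀ (σ : Equiv.Perm (Fin n)) (x : Fin n → ℝ), p (x ∘ σ) = p x)
    {F : (Fin n → ℝ) → ENNReal} (hF : Measurable F)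
    (hs : ∀ (σ : Equiv.Perm (Fin n)) (x : Fin n → ℝ), F (fun i => x (σ i)) = F x) :
    ∫⁻ ω, F (z ω) ∂P = n.factorial * ∫⁻ x in chamber n, F x * ENNReal.ofReal (p x) := by
  rw [h F hF hs]
  refine lintegral_pos_eq_factorial_mul fun σ x _ => ?_
  rw [hp]
  exact congrArg (· * _) (hs σ x)

theorem hasUnorderedDensity_of_lintegral_chamber {Ω : Type*} [MeasurableSpace Ω] {P : Measure Ω}
    {n : ℕ} {z : Ω → Fin n → ℝ} {p : (Fin n → ℝ) → ℝ}
    (hp : ∀ (σ : Equiv.Perm (Fin n)) (x : Fin n → ℝ), p (x ∘ σ) = p x)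
    (h : ∀ F : (Fin n → ℝ) → ENNReal, Measurable F →
      (∀ (σ : Equiv.Perm (Fin n)) (x : Fin n → ℝ), F (fun i => x (σ i)) = F x) →
      ∫⁻ ω, F (z ω) ∂P = n.factorial * ∫⁻ x in chamber n, F x * ENNReal.ofReal (p x)) :
    HasUnorderedDensity P z p := by
  intro F hF hs
  rw [h F hF hs, lintegral_pos_eq_factorial_mul fun σ x _ => ?_]
  rw [hp]
  exact congrArg (· * _) (hs σ x)

theorem HasUnorderedDensity.lintegral_symmetrize {Ω : Type*} [MeasurableSpace Ω] {P : Measure Ω}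
    {n : ℕ} {z : Ω → Fin n → ℝ} {p : (Fin n → ℝ) → ℝ} (h : HasUnorderedDensity P z p)
    (hp : ∀ (σ : Equiv.Perm (Fin n)) (x : Fin n → ℝ), p (x ∘ σ) = p x)
    {K : (Fin n → ℝ) → ENNReal} (hK : Measurable K) :
    ∫⁻ ω, symmetrize K (z ω) ∂P
      = n.factorial * ∫⁻ x in chamber n, K x * ENNReal.ofReal (p x) := by
  rw [h.lintegral_eq hp (measurable_symmetrize hK) (symmetrize_comp_perm K)]
  congr 1
  refine setLIntegral_congr_fun (measurableSet_chamber n) fun x hx => ?_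
  rw [symmetrize_of_mem K (σ := 1) hx]
  rfl

/-- Test the density against the indicator of the symmetric set of points with no rearrangement in
the chamber. The point is that squared singular values are almost surely distinct and positive, so
that division by `Δ(x)` and `∏ x_k` is harmless. -/
theorem HasUnorderedDensity.ae_exists_mem_chamber {Ω : Type*} [MeasurableSpace Ω] {P : Measure Ω}
    {n : ℕ} {z : Ω → Fin n → ℝ} {p : (Fin n → ℝ) → ℝ} (h : HasUnorderedDensity P z p)
    (hp : ∀ (σ : Equiv.Perm (Fin n)) (x : Fin n → ℝ), p (x ∘ σ) = p x) (hz : Measurable z) :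
    ∀ᵐ ω ∂P, ∃ σ : Equiv.Perm (Fin n), z ω ∘ σ ∈ chamber n := by
  let S : Set (Fin n → ℝ) := ⋂ σ : Equiv.Perm (Fin n), {x | x ∘ σ ∉ chamber n}
  have hS : MeasurableSet S := MeasurableSet.iInter fun σ =>
    (measurable_comp_perm σ (measurableSet_chamber n)).compl
  have h1 := h.lintegral_eq hp (F := S.indicator 1) (measurable_one.indicator hS) ?_
  · have h2 : ∫⁻ x in chamber n, S.indicator 1 x * ENNReal.ofReal (p x) = 0 := by
      rw [setLIntegral_congr_fun (g := fun _ => 0) (measurableSet_chamber n) fun x hx => ?_]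
      · simp
      · have : x ∉ S := fun hS => (Set.mem_iInter.mp hS 1) hx
        simp [Set.indicator_of_notMem this]
    rw [h2, mul_zero, lintegral_eq_zero_iff (f := fun ω => S.indicator 1 (z ω))
      ((measurable_one.indicator hS).comp hz)] at h1
    filter_upwards [h1] with ω hω
    by_contra hc
    push Not at hc
    have : z ω ∈ S := Set.mem_iInter.mpr hc
    simp [Set.indicator_of_mem this] at hω
  · intro τ x
    have : (fun i => x (τ i)) ∈ S ↔ x ∈ S := by
      refine ⟨fun h => Set.mem_iInter.mpr fun σ => ?_,
        fun h => Set.mem_iInter.mpr fun σ => Set.mem_iInter.mp h (τ * σ)⟩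
      have := Set.mem_iInter.mp h (τ⁻¹ * σ)
      simpa [Function.comp_def] using this
    by_cases hx : x ∈ S
    · rw [Set.indicator_of_mem hx, Set.indicator_of_mem (this.mpr hx)]
      rfl
    · rw [Set.indicator_of_notMem hx, Set.indicator_of_notMem (mt this.mp hx)]

/-! ### Dirichlet weights from a uniform point of a complex ball -/

/-- The disc where `π‖z‖² ≤ a` has area `a`, so the image measure agrees with Lebesgue measure on
half-open intervals. -/
theorem measurePreserving_pi_mul_norm_sq :
    MeasurePreserving (fun z : ℂ => Real.pi * ‖z‖ ^ 2) volume (volume.restrict (Set.Ioi 0)) := by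
  have hm : Measurable fun z : ℂ => Real.pi * ‖z‖ ^ 2 := by fun_prop
  refine ⟨hm, ?_⟩
  have hset : ∀ a : ℝ, 0 ≤ a → (fun z : ℂ => Real.pi * ‖z‖ ^ 2) ⁻¹' Set.Iic a
      = Metric.closedBall 0 √(a / Real.pi) := by
    intro a ha
    ext z
    simp only [Set.mem_preimage, Set.mem_Iic, mem_closedBall_zero_iff]
    rw [Real.le_sqrt (norm_nonneg z) (by positivity), le_div_iff₀ Real.pi_pos, mul_comm]
  have hvol : ∀ a : ℝ, volume ((fun z : ℂ => Real.pi * ‖z‖ ^ 2) ⁻¹' Set.Iic a)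
      = ENNReal.ofReal a := by
    intro a
    rcases lt_or_ge a 0 with ha | ha
    · rw [ENNReal.ofReal_of_nonpos ha.le, ← measure_empty (μ := (volume : Measure ℂ))]
      congr 1
      ext z
      simp only [Set.mem_preimage, Set.mem_Iic, Set.mem_empty_iff_false, iff_false, not_le]
      exact ha.trans_le (by positivity)
    · rw [hset a ha, Complex.volume_closedBall, ← ENNReal.ofReal_pow (by positivity),
        Real.sq_sqrt (by positivity), ← ENNReal.ofReal_coe_nnreal, NNReal.coe_real_pi,
        ← ENNReal.ofReal_mul (by positivity), div_mul_cancel₀ _ Real.pi_ne_zero]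
  symm
  apply Measure.ext_of_Ioc
  intro a b hab
  rw [Measure.map_apply hm measurableSet_Ioc, Measure.restrict_apply measurableSet_Ioc,
    ← Set.Iic_sdiff_Iic, Set.preimage_sdiff, measure_sdiff (Set.preimage_mono
      (Set.Iic_subset_Iic.mpr hab.le)) (hm measurableSet_Iic).nullMeasurableSet
      (by rw [hvol]; exact ENNReal.ofReal_ne_top), hvol, hvol, Set.Iic_sdiff_Iic,
    Set.Ioc_inter_Ioi, Real.volume_Ioc]
  rcases le_total a 0 with ha | ha
  · rw [max_eq_right ha, ENNReal.ofReal_of_nonpos ha, sub_zero, tsub_zero]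
  · rw [max_eq_left ha, ENNReal.ofReal_sub _ ha]

theorem lintegral_Ioo_pow_div (q : ℕ) {d u : ℝ} (hd : 0 < d) (hu : 0 ≤ u) :
    ∫⁻ s in Set.Ioo 0 u, ENNReal.ofReal (s ^ q / d)
      = ENNReal.ofReal (u ^ (q + 1) / ((q + 1) * d)) := by
  rw [← ofReal_integral_eq_lintegral_ofReal]
  · congr 1
    rw [← integral_Ioc_eq_integral_Ioo, ← intervalIntegral.integral_of_le hu,
      intervalIntegral.integral_div, integral_pow]
    field_simp
    simp
  · exact ((by fun_prop : Continuous fun s : ℝ => s ^ q / d).integrableOn_Icc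
      (a := 0) (b := u)).mono_set Set.Ioo_subset_Icc_self
  · filter_upwards [ae_restrict_mem measurableSet_Ioo] with s hs
    have := hs.1.le
    positivity

/-- `s^q / q!` is the `(q+1)`-fold convolution of the indicator of `(0,∞)`; the induction step
splits off one coordinate and integrates `s^q / q!` over `(0, u)`. -/
theorem lintegral_pi_Ioi_sum (q : ℕ) {h : ℝ → ENNReal} (hh : Measurable h) :
    ∫⁻ t, h (∑ i, t i) ∂(Measure.pi fun _ : Fin (q + 1) => volume.restrict (Set.Ioi (0 : ℝ)))
      = ∫⁻ s in Set.Ioi 0, h s * ENNReal.ofReal (s ^ q / q.factorial) := by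
  induction q generalizing h with
  | zero =>
    have hmp := measurePreserving_piUnique
      (fun _ : Fin 1 => (volume : Measure ℝ).restrict (Set.Ioi 0))
    simpa using hmp.lintegral_comp hh
  | succ q ih =>
    have hmp := measurePreserving_piFinSuccAbove
      (fun _ : Fin (q + 2) => (volume : Measure ℝ).restrict (Set.Ioi 0)) 0
    have h1 := hmp.lintegral_comp (f := fun z : ℝ × (Fin (q + 1) → ℝ) => h (z.1 + ∑ i, z.2 i))
      (by fun_prop)
    have h2 : ∀ t : Fin (q + 2) → ℝ, h (∑ i, t i) = (fun z : ℝ × (Fin (q + 1) → ℝ) =>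
        h (z.1 + ∑ i, z.2 i)) (MeasurableEquiv.piFinSuccAbove (fun _ => ℝ) 0 t) := by
      intro t
      simp [Fin.sum_univ_succ, MeasurableEquiv.piFinSuccAbove, Fin.tail]
    simp_rw [h2]
    rw [h1, lintegral_prod _ (by fun_prop)]
    have h3 : ∀ a : ℝ, ∫⁻ t, h (a + ∑ i, t i)
        ∂(Measure.pi fun _ : Fin (q + 1) => volume.restrict (Set.Ioi (0 : ℝ)))
        = ∫⁻ s in Set.Ioi 0, h (a + s) * ENNReal.ofReal (s ^ q / q.factorial) := fun a =>
      ih (h := fun s => h (a + s)) (by fun_prop)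
    simp_rw [h3]
    rw [lintegral_lintegral_swap (by fun_prop)]
    have h4 : ∀ s : ℝ, ∫⁻ a in Set.Ioi 0, h (a + s) * ENNReal.ofReal (s ^ q / q.factorial)
        = ∫⁻ u, (Set.Ioi s).indicator
          (fun u => h u * ENNReal.ofReal (s ^ q / q.factorial)) u := by
      intro s
      rw [← lintegral_add_right_eq_self (μ := volume) ((Set.Ioi s).indicator
        (fun u => h u * ENNReal.ofReal (s ^ q / q.factorial))) s,
        ← lintegral_indicator measurableSet_Ioi]
      congr 1 with a
      simp [Set.indicator_apply]
    simp_rw [h4]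
    rw [lintegral_lintegral_swap, ← lintegral_indicator measurableSet_Ioi]
    · congr 1 with u
      by_cases hu : 0 < u
      · rw [Set.indicator_of_mem (by exact hu), Nat.factorial_succ, Nat.cast_mul, Nat.cast_succ,
          ← lintegral_Ioo_pow_div q (by positivity) hu.le,
          ← lintegral_const_mul _ (by fun_prop), ← lintegral_indicator measurableSet_Ioi,
          ← lintegral_indicator measurableSet_Ioo]
        congr 1 with s
        simp only [Set.indicator_apply, Set.mem_Ioi, Set.mem_Ioo]
        by_cases h0 : 0 < s <;> by_cases h1 : s < u <;> simp [h0, h1]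
      · rw [Set.indicator_of_notMem (by exact hu)]
        rw [setLIntegral_congr_fun (g := fun _ => 0) measurableSet_Ioi fun s hs => ?_]
        · simp
        · exact Set.indicator_of_notMem (fun h => hu (lt_trans hs h)) _
    · refine Measurable.aemeasurable ?_
      have : (Function.uncurry fun s u : ℝ => (Set.Ioi s).indicator
          (fun u => h u * ENNReal.ofReal (s ^ q / q.factorial)) u)
          = {z : ℝ × ℝ | z.1 < z.2}.indicator
            (fun z => h z.2 * ENNReal.ofReal (z.1 ^ q / q.factorial)) := by
        ext z
        simp [Set.indicator_apply, Function.uncurry]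
      rw [this]
      exact Measurable.indicator (by fun_prop) (measurableSet_lt measurable_fst measurable_snd)

def openSimplex (n : ℕ) : Set (Fin n → ℝ) := {w | (∀ k, 0 < w k) ∧ ∑ k, w k < 1}

theorem measurableSet_pos (n : ℕ) : MeasurableSet {x : Fin n → ℝ | ∀ k, 0 < x k} := by
  rw [Set.ofPred_forall]
  exact MeasurableSet.iInter fun k => measurableSet_lt measurable_const (measurable_pi_apply k)

theorem measurableSet_openSimplex (n : ℕ) : MeasurableSet (openSimplex n) :=
  (measurableSet_pos n).inter (measurableSet_lt (f := fun w : Fin n → ℝ => ∑ k, w k)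
    (by fun_prop) measurable_const)

theorem pi_restrict_Ioi (n : ℕ) :
    (Measure.pi fun _ : Fin n => (volume : Measure ℝ).restrict (Set.Ioi 0))
      = (volume : Measure (Fin n → ℝ)).restrict {x | ∀ k, 0 < x k} := by
  rw [← Measure.restrict_pi_pi, volume_pi]
  congr 1
  ext x
  simp

theorem lintegral_eq_mul_lintegral_smul {n : ℕ} {S : ℝ} (hS : 0 < S)
    {Ψ : (Fin n → ℝ) → ENNReal} (hΨ : Measurable Ψ) :
    ∫⁻ a, Ψ a = ENNReal.ofReal (S ^ n) * ∫⁻ w, Ψ (S • w) := by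
  have h := Measure.map_addHaar_smul (volume : Measure (Fin n → ℝ)) hS.ne'
  rw [← lintegral_map hΨ (measurable_const_smul S), h, lintegral_smul_measure, smul_eq_mul,
    ← mul_assoc, ← ENNReal.ofReal_mul (by positivity), Module.finrank_fin_fun,
    abs_of_pos (by positivity), mul_inv_cancel₀ (by positivity), ENNReal.ofReal_one, one_mul]

/-- With `S` the total mass and `a = S w`, the radial and directional variables separate: the
scaling contributes `S^n`, and `(S - ∑ a_k)^ν = S^ν (1 - ∑ w_k)^ν`. -/
theorem lintegral_shift_simplex {n : ℕ} (ν : ℕ) {φ : (Fin n → ℝ) → ENNReal} (hφ : Measurable φ) :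
    ∫⁻ a in {a : Fin n → ℝ | ∀ k, 0 < a k}, ∫⁻ s in Set.Ioi 0,
      (Set.Iio (1 : ℝ)).indicator (fun S => φ (S⁻¹ • a)) (∑ k, a k + s)
        * ENNReal.ofReal (s ^ ν / ν.factorial)
      = (∫⁻ S in Set.Ioo (0 : ℝ) 1, ENNReal.ofReal (S ^ (n + ν) / ν.factorial))
        * ∫⁻ w in openSimplex n, φ w * ENNReal.ofReal ((1 - ∑ k, w k) ^ ν) := by
  let J : (Fin n → ℝ) × ℝ → ENNReal := {z : (Fin n → ℝ) × ℝ | ((∀ k, 0 < z.1 k) ∧ ∑ k, z.1 k < z.2)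
    ∧ z.2 < 1}.indicator
    fun z => φ (z.2⁻¹ • z.1) * ENNReal.ofReal ((z.2 - ∑ k, z.1 k) ^ ν / ν.factorial)
  have hJ : Measurable J := by
    refine Measurable.indicator ?_ ?_
    · fun_prop
    · exact (((measurableSet_pos n).preimage measurable_fst).inter
        (measurableSet_lt (by fun_prop) measurable_snd)).inter
        (measurableSet_lt measurable_snd measurable_const)
  have h1 : ∀ a ∈ {a : Fin n → ℝ | ∀ k, 0 < a k}, ∫⁻ s in Set.Ioi 0,
      (Set.Iio (1 : ℝ)).indicator (fun S => φ (S⁻¹ • a)) (∑ k, a k + s)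
        * ENNReal.ofReal (s ^ ν / ν.factorial) = ∫⁻ S, J (a, S) := by
    intro a ha
    rw [← lintegral_add_left_eq_self (μ := volume) (fun S => J (a, S)) (∑ k, a k), ← lintegral_indicator measurableSet_Ioi]
    congr 1 with s
    have ha' : ∀ k, 0 < a k := ha
    by_cases h0 : 0 < s <;> by_cases h1 : ∑ k, a k + s < 1 <;>
      simp [J, Set.indicator_apply, ha', h0, h1]
  have h2 : ∫⁻ a in {a : Fin n → ℝ | ∀ k, 0 < a k}, ∫⁻ S, J (a, S)
      = ∫⁻ a, ∫⁻ S, J (a, S) := by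
    rw [← lintegral_indicator (measurableSet_pos n)]
    congr 1 with a
    by_cases ha : ∀ k, 0 < a k
    · rw [Set.indicator_of_mem (by exact ha)]
    · rw [Set.indicator_of_notMem (by exact ha)]
      simp [J, ha]
  rw [setLIntegral_congr_fun (measurableSet_pos n) h1, h2,
    lintegral_lintegral_swap (f := fun a S => J (a, S)) hJ.aemeasurable,
    ← lintegral_mul_const _ (by fun_prop), ← lintegral_indicator measurableSet_Ioo]
  congr 1 with S
  by_cases hS : 0 < S ∧ S < 1
  · rw [Set.indicator_of_mem (by exact hS), lintegral_eq_mul_lintegral_smul hS.1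
      (by exact hJ.comp measurable_prodMk_right), pow_add, mul_div_assoc,
      ENNReal.ofReal_mul (pow_nonneg hS.1.le _), mul_assoc]
    congr 1
    rw [← lintegral_const_mul _ (by fun_prop),
      ← lintegral_indicator (measurableSet_openSimplex n)]
    refine lintegral_congr fun w => ?_
    have e1 : S⁻¹ • S • w = w := inv_smul_smul₀ hS.1.ne' w
    have e2 : ∑ k, (S • w) k = S * ∑ k, w k := by simp [Finset.mul_sum]
    have e3 : (∀ k, 0 < (S • w) k) ↔ ∀ k, 0 < w k := by simp [hS.1]
    have e4 : S * ∑ k, w k < S ↔ ∑ k, w k < 1 := by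
      rw [mul_lt_iff_lt_one_right hS.1]
    have e5 : S - S * ∑ k, w k = S * (1 - ∑ k, w k) := by ring
    by_cases hw : w ∈ openSimplex n
    · rw [Set.indicator_of_mem hw]
      have : ((S • w, S) : (Fin n → ℝ) × ℝ) ∈ {z : (Fin n → ℝ) × ℝ |
          ((∀ k, 0 < z.1 k) ∧ ∑ k, z.1 k < z.2) ∧ z.2 < 1} :=
        ⟨⟨e3.mpr hw.1, by simpa only [e2] using e4.mpr hw.2⟩, hS.2⟩
      simp only [J, Set.indicator_of_mem this, e1, e2, e5]
      rw [mul_left_comm, ← ENNReal.ofReal_mul (div_nonneg (pow_nonneg hS.1.le _) (by positivity)),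
        mul_pow]
      ring_nf
    · rw [Set.indicator_of_notMem hw]
      refine Set.indicator_of_notMem (fun h => hw ⟨e3.mp h.1.1, e4.mp ?_⟩) _
      simpa only [e2] using h.1.2
  · rw [Set.indicator_of_notMem (by exact hS)]
    rw [lintegral_eq_zero_iff (by exact hJ.comp measurable_prodMk_right)]
    refine Filter.Eventually.of_forall fun a => Set.indicator_of_notMem (fun h => hS ⟨?_, h.2⟩) _
    exact (Finset.sum_nonneg fun k _ => (h.1.1 k).le).trans_lt h.1.2

/-- The variables `π‖g_i‖²` turn Lebesgue measure on `ℂ^(n+ν+1)` into Lebesgue measure on the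
positive orthant; the last `ν + 1` of them enter only through their sum, which has density `s^ν /
ν!`. A ball replaces the unit sphere because only ratios of coordinates are used, and the factor `π`
cancels in them. -/
theorem exists_lintegral_ball_eq_mul_lintegral_simplex (n ν : ℕ) :
    ∃ c : ENNReal, c ≠ 0 ∧ c ≠ ⊤ ∧ ∀ φ : (Fin n → ℝ) → ENNReal, Measurable φ →
      ∫⁻ g in {g : Fin n ⊕ Fin (ν + 1) → ℂ | Real.pi * ∑ i, ‖g i‖ ^ 2 < 1},
        φ (fun k => ‖g (.inl k)‖ ^ 2 / ∑ i, ‖g i‖ ^ 2)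
      = c * ∫⁻ w in openSimplex n, φ w * ENNReal.ofReal ((1 - ∑ k, w k) ^ ν) := by
  refine ⟨∫⁻ S in Set.Ioo (0 : ℝ) 1, ENNReal.ofReal (S ^ (n + ν) / ν.factorial), ?_, ?_, ?_⟩
  · rw [lintegral_Ioo_pow_div _ (by positivity) zero_le_one]
    simp only [one_pow, ne_eq, ENNReal.ofReal_eq_zero, not_le]
    positivity
  · rw [lintegral_Ioo_pow_div _ (by positivity) zero_le_one]
    exact ENNReal.ofReal_ne_top
  · intro φ hφ
    let H : (Fin n → ℝ) × ℝ → ENNReal := fun z =>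
      (Set.Iio (1 : ℝ)).indicator (fun S => φ (S⁻¹ • z.1)) (∑ k, z.1 k + z.2)
    have hH : Measurable H := by
      have : H = {z : (Fin n → ℝ) × ℝ | ∑ k, z.1 k + z.2 < 1}.indicator
          fun z => φ ((∑ k, z.1 k + z.2)⁻¹ • z.1) := by
        ext z
        simp [H, Set.indicator_apply]
      rw [this]
      exact Measurable.indicator (by fun_prop) (measurableSet_lt (by fun_prop) measurable_const)
    have hmp1 := measurePreserving_pi (fun _ : Fin n ⊕ Fin (ν + 1) => (volume : Measure ℂ))
      (fun _ => (volume : Measure ℝ).restrict (Set.Ioi 0))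
      fun _ => measurePreserving_pi_mul_norm_sq
    have hmp2 := measurePreserving_sumPiEquivProdPi
      (fun _ : Fin n ⊕ Fin (ν + 1) => (volume : Measure ℝ).restrict (Set.Ioi 0))
    have h1 := (hmp2.comp hmp1).lintegral_comp
      (f := fun z : (Fin n → ℝ) × (Fin (ν + 1) → ℝ) => H (z.1, ∑ k, z.2 k)) (by fun_prop)
    rw [lintegral_prod _ (by fun_prop)] at h1
    have h2 : ∀ a : Fin n → ℝ, ∫⁻ b, H (a, ∑ k, b k)
        ∂(Measure.pi fun _ : Fin (ν + 1) => volume.restrict (Set.Ioi (0 : ℝ)))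
        = ∫⁻ s in Set.Ioi 0, H (a, s) * ENNReal.ofReal (s ^ ν / ν.factorial) := fun a =>
      lintegral_pi_Ioi_sum ν (hH.comp measurable_prodMk_left)
    simp_rw [h2] at h1
    rw [pi_restrict_Ioi, lintegral_shift_simplex ν hφ] at h1
    rw [← h1, ← lintegral_indicator (measurableSet_lt (by fun_prop) measurable_const), volume_pi]
    refine lintegral_congr fun g => ?_
    have e : ∑ i, ‖g i‖ ^ 2 = ∑ i, ‖g (.inl i)‖ ^ 2 + ∑ i, ‖g (.inr i)‖ ^ 2 :=
      Fintype.sum_sum_type _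
    simp only [Set.indicator_apply, H, Function.comp_apply, Set.mem_ofPred_eq, Set.mem_Iio, e,
      ← mul_add, ← Finset.mul_sum, MeasurableEquiv.coe_sumPiEquivProdPi, Equiv.sumPiEquivProdPi_apply]
    split_ifs
    · congr 1
      ext k
      rw [Pi.smul_apply, smul_eq_mul, mul_inv]
      field_simp
    · rfl

/-! ### The secular equation and the change of variables from weights to roots -/

/-- `y` is positive and `y_1 < x_1 < y_2 < x_2 < ⋯ < y_n < x_n`. -/
def Interlaces {n : ℕ} (y x : Fin n → ℝ) : Prop :=
  (∀ k, 0 < y k) ∧ (∀ k, y k < x k) ∧ ∀ j k, j < k → x j < y k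

/-- The monic polynomial `∏ (X - x_k) (1 + ∑ x_k w_k / (X - x_k))`. -/
noncomputable def secularPoly {n : ℕ} (x w : Fin n → ℝ) : Polynomial ℝ :=
  ∏ k, (Polynomial.X - Polynomial.C (x k))
    + ∑ k, Polynomial.C (x k * w k) *
      ∏ i ∈ Finset.univ.erase k, (Polynomial.X - Polynomial.C (x i))

/-- The weights for which `secularPoly x w` has the roots `y`. -/
noncomputable def weightMap {n : ℕ} (x y : Fin n → ℝ) (k : Fin n) : ℝ :=
  (x k * ∏ i ∈ Finset.univ.erase k, (x k - x i))⁻¹ * ∏ j, (x k - y j)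

theorem Interlaces.strictMono_left {n : ℕ} {x y : Fin n → ℝ} (h : Interlaces y x) :
    StrictMono y := fun j k hjk => (h.2.1 j).trans (h.2.2 j k hjk)

theorem Interlaces.strictMono_right {n : ℕ} {x y : Fin n → ℝ} (h : Interlaces y x) :
    StrictMono x := fun j k hjk => (h.2.2 j k hjk).trans (h.2.1 k)

theorem Interlaces.left_mem_chamber {n : ℕ} {x y : Fin n → ℝ} (h : Interlaces y x) :
    y ∈ chamber n := ⟨h.strictMono_left, h.1⟩

theorem Interlaces.right_mem_chamber {n : ℕ} {x y : Fin n → ℝ} (h : Interlaces y x) :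
    x ∈ chamber n := ⟨h.strictMono_right, fun k => (h.1 k).trans (h.2.1 k)⟩

theorem measurableSet_interlaces (n : ℕ) :
    MeasurableSet {z : (Fin n → ℝ) × (Fin n → ℝ) | Interlaces z.1 z.2} := by
  have : {z : (Fin n → ℝ) × (Fin n → ℝ) | Interlaces z.1 z.2} = (⋂ k, {z | 0 < z.1 k}) ∩
      ((⋂ k, {z | z.1 k < z.2 k}) ∩ ⋂ j, ⋂ k, {z | j < k → z.2 j < z.1 k}) := by
    ext z
    simp [Interlaces]
  rw [this]
  refine (MeasurableSet.iInter fun k => measurableSet_lt (by fun_prop) (by fun_prop)).inter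
    ((MeasurableSet.iInter fun k => measurableSet_lt (by fun_prop) (by fun_prop)).inter
      (MeasurableSet.iInter fun j => MeasurableSet.iInter fun k => ?_))
  by_cases h : j < k
  · simpa [h] using measurableSet_lt (f := fun z : (Fin n → ℝ) × (Fin n → ℝ) => z.2 j)
      (g := fun z => z.1 k) (by fun_prop) (by fun_prop)
  · simp [h]

theorem eval_prod_X_sub_C {n : ℕ} (s : Finset (Fin n)) (y : Fin n → ℝ) (z : ℝ) :
    (∏ j ∈ s, (Polynomial.X - Polynomial.C (y j))).eval z = ∏ j ∈ s, (z - y j) := by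
  simp [Polynomial.eval_prod]

theorem eval_secularPoly {n : ℕ} (x w : Fin n → ℝ) (k : Fin n) :
    (secularPoly x w).eval (x k) = x k * w k * ∏ i ∈ Finset.univ.erase k, (x k - x i) := by
  rw [secularPoly, Polynomial.eval_add, eval_prod_X_sub_C,
    Finset.prod_eq_zero (Finset.mem_univ k) (sub_self _), zero_add, Polynomial.eval_finsetSum,
    Finset.sum_eq_single k]
  · rw [Polynomial.eval_mul, eval_prod_X_sub_C, Polynomial.eval_C]
  · intro i _ hi
    rw [Polynomial.eval_mul, eval_prod_X_sub_C,
      Finset.prod_eq_zero (Finset.mem_erase.mpr ⟨hi.symm, Finset.mem_univ k⟩) (sub_self _),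
      mul_zero]
  · simp

theorem eval_zero_secularPoly {n : ℕ} (x w : Fin n → ℝ) :
    (secularPoly x w).eval 0 = (∏ k, (-x k)) * (1 - ∑ k, w k) := by
  rw [secularPoly, Polynomial.eval_add, eval_prod_X_sub_C, Polynomial.eval_finsetSum, mul_sub,
    Finset.mul_sum, mul_one, sub_eq_add_neg, ← Finset.sum_neg_distrib]
  simp only [zero_sub]
  congr 1
  refine Finset.sum_congr rfl fun k _ => ?_
  rw [Polynomial.eval_mul, eval_prod_X_sub_C, Polynomial.eval_C,
    ← Finset.mul_prod_erase _ _ (Finset.mem_univ k)]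
  simp only [zero_sub]
  ring

/-- Both polynomials are monic of degree `n`, so agreement at `n` distinct points forces equality.
-/
theorem degree_secularPoly_sub_lt {n : ℕ} (x w y : Fin n → ℝ) :
    (secularPoly x w - ∏ j, (Polynomial.X - Polynomial.C (y j))).degree < (n : WithBot ℕ) := by
  have hdeg : ∀ v : Fin n → ℝ, (∏ j, (Polynomial.X - Polynomial.C (v j))).degree = (n : WithBot ℕ) := by
    intro v
    rw [Polynomial.degree_eq_natDegree (Polynomial.monic_prod_X_sub_C _ _).ne_zero,
      Polynomial.natDegree_finsetProd_X_sub_C_eq_card]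
    simp
  rw [secularPoly, add_sub_right_comm, ← Polynomial.mem_degreeLT]
  refine Submodule.add_mem _ ?_ (Submodule.sum_mem _ fun k _ => ?_)
  · rw [Polynomial.mem_degreeLT]
    refine (Polynomial.degree_sub_lt_left ?_ (Polynomial.monic_prod_X_sub_C _ _).ne_zero ?_).trans_eq
      (hdeg x)
    · rw [hdeg, hdeg]
    · rw [(Polynomial.monic_prod_X_sub_C _ _).leadingCoeff,
        (Polynomial.monic_prod_X_sub_C _ _).leadingCoeff]
  · rw [← Polynomial.smul_eq_C_mul]
    refine Submodule.smul_mem _ _ ?_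
    rw [Polynomial.mem_degreeLT,
      Polynomial.degree_eq_natDegree (Polynomial.monic_prod_X_sub_C _ _).ne_zero,
      Polynomial.natDegree_finsetProd_X_sub_C_eq_card, Finset.card_erase_of_mem (Finset.mem_univ k)]
    have := k.pos
    simp only [Finset.card_univ, Fintype.card_fin, Nat.cast_lt]
    omega

theorem secularPoly_eq_of_eval {n : ℕ} {x w y v : Fin n → ℝ} (hv : Function.Injective v)
    (h : ∀ k, (secularPoly x w).eval (v k) = ∏ j, (v k - y j)) :
    secularPoly x w = ∏ j, (Polynomial.X - Polynomial.C (y j)) := by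
  refine Polynomial.eq_of_degree_sub_lt_of_eval_index_eq Finset.univ (v := v) hv.injOn ?_ ?_
  · simpa using degree_secularPoly_sub_lt x w y
  · intro k _
    rw [h k, eval_prod_X_sub_C]

theorem prod_erase_sub_ne_zero {n : ℕ} {x : Fin n → ℝ} (hx : Function.Injective x) (k : Fin n) :
    ∏ i ∈ Finset.univ.erase k, (x k - x i) ≠ 0 :=
  Finset.prod_ne_zero_iff.mpr fun _ hi =>
    sub_ne_zero.mpr fun h => (Finset.mem_erase.mp hi).1 (hx h).symm

theorem secularPoly_weightMap {n : ℕ} {x : Fin n → ℝ} (hx : x ∈ chamber n) (y : Fin n → ℝ) :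
    secularPoly x (weightMap x y) = ∏ j, (Polynomial.X - Polynomial.C (y j)) := by
  refine secularPoly_eq_of_eval hx.1.injective fun k => ?_
  rw [eval_secularPoly, weightMap]
  have h1 := prod_erase_sub_ne_zero hx.1.injective k
  have h2 := (hx.2 k).ne'
  field_simp

theorem weightMap_eq_of_secularPoly {n : ℕ} {x : Fin n → ℝ} (hx : x ∈ chamber n)
    {w y : Fin n → ℝ} (h : secularPoly x w = ∏ j, (Polynomial.X - Polynomial.C (y j))) :
    weightMap x y = w := by
  funext k
  have h1 := prod_erase_sub_ne_zero hx.1.injective k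
  have h2 := (hx.2 k).ne'
  have h3 := congrArg (Polynomial.eval (x k)) h
  rw [eval_secularPoly, eval_prod_X_sub_C] at h3
  rw [weightMap, ← h3]
  field_simp

/-- This is the secular polynomial evaluated at `0`; it converts the Dirichlet density into the
factor `∏ y_k^ν / ∏ x_k^ν`. -/
theorem one_sub_sum_weightMap {n : ℕ} {x : Fin n → ℝ} (hx : x ∈ chamber n) (y : Fin n → ℝ) :
    1 - ∑ k, weightMap x y k = (∏ k, y k) / ∏ k, x k := by
  have h := congrArg (Polynomial.eval 0) (secularPoly_weightMap hx y)
  rw [eval_zero_secularPoly, eval_prod_X_sub_C] at h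
  simp only [zero_sub, Finset.prod_neg, mul_assoc] at h
  have h1 : (-1 : ℝ) ^ (Finset.univ : Finset (Fin n)).card ≠ 0 := by simp
  rw [eq_div_iff (Finset.prod_pos fun k _ => hx.2 k).ne', mul_comm]
  exact mul_left_cancel₀ h1 h

/-- Interlacing gives `x_k - y_i` and `x_k - x_i` the same sign for `i ≠ k`, so every weight is
positive; the sum is below `1` by evaluation at `0`. -/
theorem weightMap_mem_openSimplex {n : ℕ} {x y : Fin n → ℝ} (h : Interlaces y x) :
    weightMap x y ∈ openSimplex n := by
  have hx := h.right_mem_chamber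
  refine ⟨fun k => ?_, ?_⟩
  · have : weightMap x y k = (x k)⁻¹ * (x k - y k) *
        ∏ i ∈ Finset.univ.erase k, ((x k - y i) / (x k - x i)) := by
      rw [weightMap, Finset.prod_div_distrib, ← Finset.mul_prod_erase _ _ (Finset.mem_univ k),
        mul_inv]
      ring
    rw [this]
    refine mul_pos (mul_pos (inv_pos.mpr (hx.2 k)) (sub_pos.mpr (h.2.1 k)))
      (Finset.prod_pos fun i hi => ?_)
    rcases lt_or_gt_of_ne (Finset.mem_erase.mp hi).1 with hik | hik
    · exact div_pos (sub_pos.mpr ((h.2.1 i).trans (hx.1 hik))) (sub_pos.mpr (hx.1 hik))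
    · exact div_pos_of_neg_of_neg (sub_neg.mpr (h.2.2 k i hik)) (sub_neg.mpr (hx.1 hik))
  · rw [← sub_pos, one_sub_sum_weightMap hx]
    exact div_pos (Finset.prod_pos fun k _ => h.1 k) (Finset.prod_pos fun k _ => hx.2 k)

/-- The weights determine the polynomial, hence its multiset of roots, and interlacing fixes their
order. -/
theorem weightMap_injOn {n : ℕ} {x : Fin n → ℝ} (hx : x ∈ chamber n) :
    Set.InjOn (weightMap x) {y | Interlaces y x} := by
  intro y hy y' hy' h
  have h1 := secularPoly_weightMap hx y
  rw [h, secularPoly_weightMap hx y'] at h1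
  have h2 := congrArg Polynomial.roots h1
  rw [Polynomial.roots_prod _ _ (by simp [Finset.prod_ne_zero_iff, Polynomial.X_sub_C_ne_zero]),
    Polynomial.roots_prod _ _ (by simp [Finset.prod_ne_zero_iff, Polynomial.X_sub_C_ne_zero])] at h2
  obtain ⟨σ, hσ⟩ := exists_perm_of_map_univ_eq (f := y') (g := y) (by simpa using h2)
  have : σ = 1 := perm_eq_of_comp_mem_chamber (x := y') (hσ ▸ hy.left_mem_chamber)
    hy'.left_mem_chamber
  rw [← hσ, this]
  rfl

theorem neg_one_pow_mul_prod_erase_pos {n : ℕ} {x : Fin n → ℝ} (hx : StrictMono x) (k : Fin n) :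
    0 < (-1) ^ (n - 1 - (k : ℕ)) * ∏ i ∈ Finset.univ.erase k, (x k - x i) := by
  have h : Finset.univ.erase k = Finset.Iio k ∪ Finset.Ioi k := by
    ext i
    simp
  rw [h, Finset.prod_union (Finset.disjoint_left.mpr fun i h1 h2 =>
    lt_asymm (Finset.mem_Iio.mp h1) (Finset.mem_Ioi.mp h2)), ← Fin.card_Ioi k, mul_left_comm,
    ← Finset.prod_neg]
  refine mul_pos (Finset.prod_pos fun i hi => ?_) (Finset.prod_pos fun i hi => ?_)
  · exact sub_pos.mpr (hx (Finset.mem_Iio.mp hi))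
  · exact neg_pos.mpr (sub_neg.mpr (hx (Finset.mem_Ioi.mp hi)))

/-- The secular polynomial alternates in sign along `0, x_1, …, x_n`, so it has a root in each of
the `n` gaps. -/
theorem exists_interlaces_weightMap_eq {n : ℕ} {x w : Fin n → ℝ} (hx : x ∈ chamber n)
    (hw : w ∈ openSimplex n) : ∃ y, Interlaces y x ∧ weightMap x y = w := by
  -- The point `0` is prepended to provide the left end of the lowest gap; positivity there is the
  -- condition `∑ w_k < 1`.
  let a : Fin (n + 1) → ℝ := Fin.cons 0 x
  let Q : ℝ → ℝ := fun z => (secularPoly x w).eval z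
  have hQ : Continuous Q := (secularPoly x w).continuous
  have hsign : ∀ i : Fin (n + 1), 0 < (-1) ^ (n - (i : ℕ)) * Q (a i) := by
    intro i
    refine Fin.cases ?_ (fun k => ?_) i
    · simp only [Q, a, Fin.cons_zero, eval_zero_secularPoly, Finset.prod_neg, Fin.val_zero,
        Nat.sub_zero, Finset.card_univ, Fintype.card_fin]
      rw [mul_assoc, ← mul_assoc, ← mul_pow]
      simpa using mul_pos (Finset.prod_pos fun k _ => hx.2 k) (sub_pos.mpr hw.2)
    · simp only [Q, a, Fin.cons_succ, eval_secularPoly, Fin.val_succ]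
      rw [mul_left_comm, Nat.sub_add_eq, Nat.sub_right_comm]
      exact mul_pos (mul_pos (hx.2 k) (hw.1 k)) (neg_one_pow_mul_prod_erase_pos hx.1 k)
  have ha : ∀ k : Fin n, a k.castSucc < a k.succ := by
    intro k
    have hk : 0 < x k := hx.2 k
    obtain ⟨n', rfl⟩ : ∃ n', n = n' + 1 := ⟨n - 1, by have := k.pos; omega⟩
    refine Fin.cases (fun _ => ?_) (fun j _ => ?_) k hk
    · simpa [a] using hx.2 0
    · simp only [a, Fin.cons_succ, Fin.castSucc_succ]
      exact hx.1 Fin.castSucc_lt_succ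
  have hroot : ∀ k : Fin n, ∃ z, a k.castSucc < z ∧ z < x k ∧ Q z = 0 := by
    intro k
    have h1 := hsign k.castSucc
    have h2 := hsign k.succ
    have hpow : (-1 : ℝ) ^ (n - (k.castSucc : ℕ)) = -(-1) ^ (n - (k.succ : ℕ)) := by
      have : n - (k.castSucc : ℕ) = (n - (k.succ : ℕ)) + 1 := by
        have := k.isLt
        simp only [Fin.val_castSucc, Fin.val_succ]
        omega
      rw [this, pow_succ, mul_neg_one]
    let R : ℝ → ℝ := fun z => (-1) ^ (n - (k.succ : ℕ)) * Q z
    have hR : Continuous R := continuous_const.mul hQ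
    obtain ⟨z, hz, hz0⟩ := intermediate_value_Ioo (ha k).le hR.continuousOn
      (show (0 : ℝ) ∈ Set.Ioo (R (a k.castSucc)) (R (a k.succ)) from
        ⟨by rw [hpow] at h1; simp only [R]; linarith, h2⟩)
    refine ⟨z, hz.1, by simpa [a] using hz.2, ?_⟩
    simpa [R] using hz0
  choose y hy1 hy2 hy3 using hroot
  have hamono : StrictMono a := Fin.strictMono_iff_lt_succ.mpr ha
  have hy : Interlaces y x := by
    refine ⟨fun k => ?_, hy2, fun j k hjk => ?_⟩
    · exact (hamono.monotone (Fin.zero_le k.castSucc)).trans_lt (hy1 k)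
    · refine lt_of_le_of_lt ?_ (hy1 k)
      have : j.succ ≤ k.castSucc := Fin.succ_le_castSucc_iff.mpr hjk
      simpa [a] using hamono.monotone this
  refine ⟨y, hy, weightMap_eq_of_secularPoly hx
    (secularPoly_eq_of_eval hy.strictMono_left.injective fun k => ?_)⟩
  rw [Finset.prod_eq_zero (Finset.mem_univ k) (sub_self _)]
  exact hy3 k

theorem image_weightMap {n : ℕ} {x : Fin n → ℝ} (hx : x ∈ chamber n) :
    weightMap x '' {y | Interlaces y x} = openSimplex n := by
  ext w
  constructor
  · rintro ⟨y, hy, rfl⟩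
    exact weightMap_mem_openSimplex hy
  · intro hw
    obtain ⟨y, hy, rfl⟩ := exists_interlaces_weightMap_eq hx hw
    exact ⟨y, hy, rfl⟩

theorem abs_prod_prod_erase_sub {n : ℕ} (y : Fin n → ℝ) :
    |∏ j, ∏ i ∈ Finset.univ.erase j, (y j - y i)|
      = |∏ j : Fin n, ∏ k ∈ Finset.Ioi j, (y k - y j)| ^ 2 := by
  have h : ∀ j : Fin n, Finset.univ.erase j = Finset.Iio j ∪ Finset.Ioi j := by
    intro j
    ext i
    simp
  have hd : ∀ j : Fin n, Disjoint (Finset.Iio j) (Finset.Ioi j) := fun j =>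
    Finset.disjoint_left.mpr fun i h1 h2 =>
      lt_asymm (Finset.mem_Iio.mp h1) (Finset.mem_Ioi.mp h2)
  simp_rw [h, Finset.prod_union (hd _), Finset.prod_mul_distrib, Finset.abs_prod, abs_mul,
    Finset.abs_prod, sq]
  congr 1
  · exact Finset.prod_comm' fun j i => by simp
  · exact Finset.prod_congr rfl fun j _ => Finset.prod_congr rfl fun i _ => abs_sub_comm _ _

/-- The columns are the values at `x` of the unnormalised Lagrange polynomials for the nodes `y`, so
the matrix is the Vandermonde matrix of `x` times a coefficient matrix. Taking `x = y` makes the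
product diagonal, which shows that the coefficient matrix has determinant `±Δ(y)`. -/
theorem abs_det_prod_erase_sub {n : ℕ} (x : Fin n → ℝ) {y : Fin n → ℝ}
    (hy : Function.Injective y) :
    |(Matrix.of fun k j : Fin n => ∏ i ∈ Finset.univ.erase j, (x k - y i)).det|
      = |∏ j : Fin n, ∏ k ∈ Finset.Ioi j, (x k - x j)|
        * |∏ j : Fin n, ∏ k ∈ Finset.Ioi j, (y k - y j)| := by
  let L : Fin n → Polynomial ℝ := fun j =>
    ∏ i ∈ Finset.univ.erase j, (Polynomial.X - Polynomial.C (y i))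
  let Cm : Matrix (Fin n) (Fin n) ℝ := Matrix.of fun i j => (L j).coeff i
  have hL : ∀ z : Fin n → ℝ, (Matrix.of fun k j : Fin n => ∏ i ∈ Finset.univ.erase j, (z k - y i))
      = Matrix.vandermonde z * Cm := by
    intro z
    ext k j
    have hdeg : (L j).natDegree < n := by
      rw [Polynomial.natDegree_finsetProd_X_sub_C_eq_card,
        Finset.card_erase_of_mem (Finset.mem_univ j)]
      have := j.pos
      simp only [Finset.card_univ, Fintype.card_fin]
      omega
    rw [Matrix.of_apply, ← eval_prod_X_sub_C, Polynomial.eval_eq_sum_range' hdeg, Matrix.mul_apply,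
      ← Fin.sum_univ_eq_sum_range (fun i => (L j).coeff i * z k ^ i)]
    exact Finset.sum_congr rfl fun i _ => by simp [Cm, Matrix.vandermonde_apply, mul_comm]
  have hdiag : (Matrix.of fun k j : Fin n => ∏ i ∈ Finset.univ.erase j, (y k - y i))
      = Matrix.diagonal fun j => ∏ i ∈ Finset.univ.erase j, (y j - y i) := by
    ext k j
    rw [Matrix.of_apply, Matrix.diagonal_apply]
    split_ifs with h
    · rw [h]
    · exact Finset.prod_eq_zero (Finset.mem_erase.mpr ⟨h, Finset.mem_univ k⟩) (sub_self _)
  have h1 := congrArg (fun M => |Matrix.det M|) (hL y)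
  rw [hdiag] at h1
  simp only [Matrix.det_diagonal, Matrix.det_mul, abs_mul, abs_prod_prod_erase_sub,
    Matrix.det_vandermonde] at h1
  have h2 : |∏ j : Fin n, ∏ k ∈ Finset.Ioi j, (y k - y j)| ≠ 0 := by
    rw [← Matrix.det_vandermonde, abs_ne_zero]
    exact Matrix.det_vandermonde_ne_zero_iff.mpr hy
  rw [sq] at h1
  rw [hL x, Matrix.det_mul, abs_mul, ← mul_left_cancel₀ h2 h1, Matrix.det_vandermonde]

/-- The Jacobian matrix of `weightMap x` at `y`. -/
noncomputable def weightJacobian {n : ℕ} (x y : Fin n → ℝ) : Matrix (Fin n) (Fin n) ℝ :=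
  Matrix.of fun k j => -(x k * ∏ i ∈ Finset.univ.erase k, (x k - x i))⁻¹ *
    ∏ i ∈ Finset.univ.erase j, (x k - y i)

theorem hasFDerivAt_weightMap {n : ℕ} (x y : Fin n → ℝ) :
    HasFDerivAt (weightMap x) (LinearMap.toContinuousLinearMap (weightJacobian x y).toLin') y := by
  rw [hasFDerivAt_pi']
  intro k
  have h1 : ∀ j ∈ (Finset.univ : Finset (Fin n)), HasFDerivAt (fun y : Fin n → ℝ => x k - y j)
      (-ContinuousLinearMap.proj (R := ℝ) (φ := fun _ => ℝ) j) y := fun j _ =>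
    (hasFDerivAt_apply j y).const_sub (x k)
  have h2 := (HasFDerivAt.finsetProd h1).const_mul
    (x k * ∏ i ∈ Finset.univ.erase k, (x k - x i))⁻¹
  refine h2.congr_fderiv ?_
  ext v
  simp [weightJacobian, Matrix.mulVec, dotProduct, Finset.mul_sum, mul_assoc]

/-- The row factors contribute `∏ x_k` and `Δ(x)²` in the denominator, and the remaining determinant
is `±Δ(x)Δ(y)`. -/
theorem abs_det_weightJacobian {n : ℕ} {x y : Fin n → ℝ} (h : Interlaces y x) :
    |(weightJacobian x y).det| = (∏ k, x k)⁻¹ * (∏ j : Fin n, ∏ k ∈ Finset.Ioi j, (x k - x j))⁻¹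
      * ∏ j : Fin n, ∏ k ∈ Finset.Ioi j, (y k - y j) := by
  have hx := vandermonde_pos h.strictMono_right
  have hy := vandermonde_pos h.strictMono_left
  have h0 : weightJacobian x y = Matrix.of fun k j =>
      -(x k * ∏ i ∈ Finset.univ.erase k, (x k - x i))⁻¹ *
        (Matrix.of fun k j : Fin n => ∏ i ∈ Finset.univ.erase j, (x k - y i)) k j := rfl
  rw [h0, Matrix.det_mul_column, abs_mul, abs_det_prod_erase_sub x h.strictMono_left.injective,
    Finset.prod_neg, abs_mul, abs_pow, abs_neg, abs_one, one_pow, one_mul, Finset.prod_inv_distrib,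
    Finset.prod_mul_distrib, abs_inv, abs_mul, abs_prod_prod_erase_sub, abs_of_pos hx,
    abs_of_pos hy, abs_of_pos (Finset.prod_pos fun k _ => h.right_mem_chamber.2 k)]
  field_simp

/-- Change of variables `w = weightMap x y`. Of the exponent `ν + 1` on `x_k`, `ν` comes from the
density and one from the Jacobian. -/
theorem lintegral_simplex_eq_lintegral_interlaces {n : ℕ} {x : Fin n → ℝ} (hx : x ∈ chamber n)
    (ν : ℕ) (φ : (Fin n → ℝ) → ENNReal) :
    ∫⁻ w in openSimplex n, φ w * ENNReal.ofReal ((1 - ∑ k, w k) ^ ν)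
      = ENNReal.ofReal ((∏ k, x k ^ (ν + 1))⁻¹ *
          (∏ j : Fin n, ∏ k ∈ Finset.Ioi j, (x k - x j))⁻¹) *
        ∫⁻ y in {y | Interlaces y x}, φ (weightMap x y) *
          ENNReal.ofReal ((∏ k, y k ^ ν) * ∏ j : Fin n, ∏ k ∈ Finset.Ioi j, (y k - y j)) := by
  have hm : MeasurableSet {y | Interlaces y x} :=
    (measurableSet_interlaces n).preimage measurable_prodMk_right
  have hV := vandermonde_pos hx.1
  have hP : 0 < ∏ k, x k := Finset.prod_pos fun k _ => hx.2 k
  rw [← image_weightMap hx, lintegral_image_eq_lintegral_abs_det_fderiv_mul volume hm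
    (fun y _ => (hasFDerivAt_weightMap x y).hasFDerivWithinAt) (weightMap_injOn hx),
    ← lintegral_const_mul' _ _ ENNReal.ofReal_ne_top]
  refine setLIntegral_congr_fun hm fun y hy => ?_
  have hVy := vandermonde_pos hy.strictMono_left
  have hPy : 0 < ∏ k, y k := Finset.prod_pos fun k _ => hy.1 k
  rw [LinearMap.det_toContinuousLinearMap, LinearMap.det_toLin', abs_det_weightJacobian hy,
    one_sub_sum_weightMap hx, mul_left_comm, mul_left_comm _ (φ _), ← ENNReal.ofReal_mul
    (by positivity), ← ENNReal.ofReal_mul (by rw [Finset.prod_pow]; positivity), Finset.prod_pow,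
    Finset.prod_pow, div_pow]
  congr 2
  field_simp
  ring

/-! ### Rank-one deflation of a Gram matrix in a random direction -/

/-- `B* (1 - u* u) B` for a row vector `u`. -/
noncomputable def deflatedGram {ι : Type*} [Fintype ι] {n : ℕ} (B : Matrix ι (Fin n) ℂ) (u : ι → ℂ) :
    Matrix (Fin n) (Fin n) ℂ :=
  Bᴴ * B - Matrix.vecMulVec (star (u ᵥ* B)) (u ᵥ* B)

theorem isHermitian_deflatedGram {ι : Type*} [Fintype ι] {n : ℕ} (B : Matrix ι (Fin n) ℂ)
    (u : ι → ℂ) : (deflatedGram B u).IsHermitian := by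
  refine (Matrix.isHermitian_conjTranspose_mul_self B).sub ?_
  rw [Matrix.IsHermitian, Matrix.conjTranspose_vecMulVec, star_star]

theorem deflatedGram_mul {ι : Type*} [Fintype ι] [DecidableEq ι] {n : ℕ} (B : Matrix ι (Fin n) ℂ)
    (V : Matrix.unitaryGroup ι ℂ) (u : ι → ℂ) :
    deflatedGram ((V : Matrix ι ι ℂ) * B) u = deflatedGram B (u ᵥ* (V : Matrix ι ι ℂ)) := by
  have h : (V : Matrix ι ι ℂ)ᴴ * (V : Matrix ι ι ℂ) = 1 := Matrix.UnitaryGroup.star_mul_self V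
  rw [deflatedGram, deflatedGram, Matrix.conjTranspose_mul, Matrix.mul_assoc,
    ← Matrix.mul_assoc _ _ B, h, Matrix.one_mul, Matrix.vecMul_vecMul]

theorem measurable_deflatedGram {α ι : Type*} [MeasurableSpace α] [Fintype ι] {n : ℕ}
    {B : α → Matrix ι (Fin n) ℂ} {u : α → ι → ℂ} (hB : Measurable B) (hu : Measurable u) :
    Measurable fun a => deflatedGram (B a) (u a) := by
  have hB' : ∀ i j, Measurable fun a => B a i j := fun i j =>
    measurable_pi_iff.mp (measurable_pi_iff.mp hB i) j
  have hu' : ∀ i, Measurable fun a => u a i := measurable_pi_iff.mp hu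
  refine measurable_pi_iff.mpr fun i => measurable_pi_iff.mpr fun j => ?_
  simp only [deflatedGram, Matrix.sub_apply, Matrix.mul_apply, Matrix.conjTranspose_apply,
    Matrix.vecMulVec_apply, Matrix.vecMul, dotProduct, Pi.star_apply]
  fun_prop

/-- A Gram matrix is the sum of the rank-one contributions of its rows, so deflating along the last
coordinate row deletes the last row. -/
theorem deflatedGram_single_last {N n : ℕ} (B : Matrix (Fin (N + 1)) (Fin n) ℂ) :
    deflatedGram B (Pi.single (Fin.last N) 1)
      = (B.submatrix Fin.castSucc id)ᴴ * B.submatrix Fin.castSucc id := by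
  ext i j
  simp [deflatedGram, Matrix.mul_apply, Matrix.vecMulVec_apply, Fin.sum_univ_castSucc]

theorem eigenvalues_congr {n : ℕ} {H H' : Matrix (Fin n) (Fin n) ℂ} (h : H = H')
    (hH : H.IsHermitian) (hH' : H'.IsHermitian) : hH.eigenvalues = hH'.eigenvalues := by
  subst h
  rfl

theorem exists_unitary_row_eq {ι : Type*} [Fintype ι] [DecidableEq ι] (i₀ : ι) {u : ι → ℂ}
    (hu : ∑ i, ‖u i‖ ^ 2 = 1) :
    ∃ V : Matrix.unitaryGroup ι ℂ, Pi.single i₀ 1 ᵥ* (V : Matrix ι ι ℂ) = u := by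
  have ho : Orthonormal ℂ (({i₀} : Set ι).domRestrict fun _ => WithLp.toLp 2 u) := by
    rw [orthonormal_iff_ite]
    intro i j
    rw [if_pos (Subsingleton.elim i j)]
    change inner ℂ (WithLp.toLp 2 u) (WithLp.toLp 2 u) = 1
    rw [EuclideanSpace.inner_eq_star_dotProduct, dotProduct]
    simp only [Pi.star_apply, Complex.star_def, Complex.mul_conj, Complex.normSq_eq_norm_sq]
    exact_mod_cast hu
  obtain ⟨b, hb⟩ := ho.exists_orthonormalBasis_extension_of_card_eq (by simp)
  let V : Matrix ι ι ℂ := Matrix.of fun i j => b i j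
  have hV : V * star V = 1 := by
    ext i j
    have := orthonormal_iff_ite.mp b.orthonormal j i
    rw [EuclideanSpace.inner_eq_star_dotProduct] at this
    rw [Matrix.mul_apply, Matrix.one_apply]
    simp only [eq_comm (a := i)]
    rw [← this]
    rfl
  refine ⟨⟨V, Matrix.mem_unitaryGroup_iff.mpr hV⟩, ?_⟩
  funext j
  simp [V, hb i₀ (Set.mem_singleton i₀)]

/-- For `z` off the `x_k`, factor out `z - diag(x)` and apply the matrix determinant lemma to the
rank-one perturbation of the identity; infinitely many such `z` suffice. -/
theorem charpoly_diagonal_sub_vecMulVec {n : ℕ} {x w : Fin n → ℝ} {c : Fin n → ℂ}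
    (hc : ∀ k, ‖c k‖ ^ 2 = x k * w k) :
    (Matrix.diagonal (fun k => (x k : ℂ)) - Matrix.vecMulVec (star c) c).charpoly
      = (secularPoly x w).map Complex.ofRealHom := by
  refine Polynomial.eq_of_infinite_eval_eq _ _
    (Set.Infinite.mono (s := (Finset.univ.image fun k => (x k : ℂ) : Set ℂ)ᶜ) ?_
      (Set.Finite.infinite_compl (Finset.finite_toSet _)))
  intro z hz
  have hz' : ∀ k, z - x k ≠ 0 := by
    intro k h
    apply hz
    simp only [Finset.coe_image, Finset.coe_univ, Set.image_univ, Set.mem_range]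
    exact ⟨k, (sub_eq_zero.mp h).symm⟩
  show _ = _
  rw [Matrix.eval_charpoly]
  have h1 : Matrix.scalar (Fin n) z
      - (Matrix.diagonal (fun k => (x k : ℂ)) - Matrix.vecMulVec (star c) c)
      = Matrix.diagonal (fun k => z - x k) * (1 + Matrix.replicateCol Unit
        (fun k => (z - x k)⁻¹ * star (c k)) * Matrix.replicateRow Unit c) := by
    ext i j
    rw [Matrix.diagonal_mul, Matrix.sub_apply, Matrix.sub_apply, Matrix.add_apply]
    simp only [Matrix.scalar_apply, Matrix.diagonal_apply, Matrix.vecMulVec_apply, Matrix.one_apply,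
      Matrix.mul_apply, Matrix.replicateCol_apply, Matrix.replicateRow_apply, Pi.star_apply]
    have := hz' i
    split_ifs <;> simp <;> field_simp <;> ring
  rw [h1, Matrix.det_mul, Matrix.det_diagonal, Matrix.det_one_add_replicateCol_mul_replicateRow,
    secularPoly, Polynomial.map_add, Polynomial.eval_add, mul_add, mul_one, Polynomial.map_sum,
    Polynomial.eval_finsetSum, dotProduct, Finset.mul_sum]
  congr 1
  · simp [Polynomial.map_prod, Polynomial.eval_prod]
  · refine Finset.sum_congr rfl fun k _ => ?_
    have h2 : c k * star (c k) = (x k : ℂ) * w k := by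
      rw [Complex.star_def, Complex.mul_conj, Complex.normSq_eq_norm_sq, hc k]
      push_cast
      rfl
    rw [← Finset.mul_prod_erase _ _ (Finset.mem_univ k)]
    simp only [Polynomial.map_mul, Polynomial.map_prod, Polynomial.eval_mul, Polynomial.eval_prod,
      Polynomial.map_sub, Polynomial.map_X, Polynomial.map_C, Polynomial.eval_sub,
      Polynomial.eval_X, Polynomial.eval_C, Complex.ofRealHom_eq_coe, Complex.ofReal_mul]
    rw [← h2]
    have := hz' k
    field_simp

def normSqBall (ι : Type*) [Fintype ι] : Set (ι → ℂ) := {g | Real.pi * ∑ i, ‖g i‖ ^ 2 < 1}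

theorem isOpen_normSqBall (ι : Type*) [Fintype ι] : IsOpen (normSqBall ι) :=
  isOpen_lt (by fun_prop) continuous_const

theorem measurableSet_normSqBall (ι : Type*) [Fintype ι] : MeasurableSet (normSqBall ι) :=
  (isOpen_normSqBall ι).measurableSet

theorem volume_normSqBall_ne_zero (ι : Type*) [Fintype ι] :
    (volume : Measure (ι → ℂ)) (normSqBall ι) ≠ 0 :=
  ((isOpen_normSqBall ι).measure_pos volume ⟨0, by simp [normSqBall]⟩).ne'

theorem volume_normSqBall_ne_top (ι : Type*) [Fintype ι] :
    (volume : Measure (ι → ℂ)) (normSqBall ι) ≠ ⊤ := by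
  refine ((measure_mono ?_).trans_lt
    (measure_ball_lt_top (μ := (volume : Measure (ι → ℂ))) (x := 0) (r := 1))).ne
  intro g hg
  rw [mem_ball_zero_iff, pi_norm_lt_iff one_pos]
  intro i
  have h1 : ‖g i‖ ^ 2 ≤ ∑ i, ‖g i‖ ^ 2 :=
    Finset.single_le_sum (f := fun i => ‖g i‖ ^ 2) (fun _ _ => by positivity) (Finset.mem_univ i)
  have h2 : ∑ i, ‖g i‖ ^ 2 ≤ Real.pi * ∑ i, ‖g i‖ ^ 2 :=
    le_mul_of_one_le_left (Finset.sum_nonneg fun _ _ => by positivity)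
      (by linarith [Real.pi_gt_three])
  have h3 : Real.pi * ∑ i, ‖g i‖ ^ 2 < 1 := hg
  exact (sq_lt_one_iff₀ (norm_nonneg _)).mp (by linarith)

theorem sum_norm_sq_vecMul_unitary {ι : Type*} [Fintype ι] [DecidableEq ι]
    (V : Matrix.unitaryGroup ι ℂ) (g : ι → ℂ) :
    ∑ i, ‖(g ᵥ* (V : Matrix ι ι ℂ)) i‖ ^ 2 = ∑ i, ‖g i‖ ^ 2 := by
  have h : ∀ g : ι → ℂ, ((∑ i, ‖g i‖ ^ 2 : ℝ) : ℂ) = g ⬝ᵥ star g := by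
    intro g
    simp only [dotProduct, Pi.star_apply, Complex.star_def, Complex.mul_conj,
      Complex.normSq_eq_norm_sq]
    push_cast
    rfl
  have hV : (V : Matrix ι ι ℂ) * (V : Matrix ι ι ℂ)ᴴ = 1 :=
    Matrix.mem_unitaryGroup_iff.mp V.2
  have : ((∑ i, ‖(g ᵥ* (V : Matrix ι ι ℂ)) i‖ ^ 2 : ℝ) : ℂ) = ((∑ i, ‖g i‖ ^ 2 : ℝ) : ℂ) := by
    rw [h, h, Matrix.star_vecMul, ← Matrix.dotProduct_mulVec, Matrix.mulVec_mulVec, hV,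
      Matrix.one_mulVec]
  exact_mod_cast this

/-- An invertible linear map scales Lebesgue measure by a constant, and the constant is `1` because
the Euclidean ball, of finite nonzero volume, is its own preimage. -/
theorem measurePreserving_vecMul_unitary {ι : Type*} [Fintype ι] [DecidableEq ι]
    (V : Matrix.unitaryGroup ι ℂ) :
    MeasurePreserving (fun g : ι → ℂ => g ᵥ* (V : Matrix ι ι ℂ)) volume volume := by
  let L : (ι → ℂ) →ₗ[ℝ] (ι → ℂ) := (Matrix.vecMulLinear (V : Matrix ι ι ℂ)).restrictScalars ℝ
  have hL : Continuous L := L.continuous_of_finiteDimensional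
  have hV : (V : Matrix ι ι ℂ) * (V : Matrix ι ι ℂ)ᴴ = 1 :=
    Matrix.mem_unitaryGroup_iff.mp V.2
  have hinj : Function.Injective L := by
    intro a b hab
    have : a ᵥ* (V : Matrix ι ι ℂ) = b ᵥ* (V : Matrix ι ι ℂ) := hab
    have h2 := congrArg (· ᵥ* (V : Matrix ι ι ℂ)ᴴ) this
    simpa [Matrix.vecMul_vecMul, hV] using h2
  have hdet : LinearMap.det L ≠ 0 :=
    ((LinearMap.isUnit_iff_ker_eq_bot L).mpr (LinearMap.ker_eq_bot.mpr hinj)).map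
      LinearMap.det |>.ne_zero
  have hmap := Measure.map_linearMap_addHaar_eq_smul_addHaar (volume : Measure (ι → ℂ)) hdet
  have hpre : L ⁻¹' normSqBall ι = normSqBall ι := by
    ext g
    simp only [normSqBall, Set.mem_preimage, Set.mem_ofPred_eq]
    rw [← sum_norm_sq_vecMul_unitary V g]
    rfl
  have hc := congrArg (fun μ => μ (normSqBall ι)) hmap
  simp only [Measure.smul_apply, smul_eq_mul] at hc
  rw [Measure.map_apply hL.measurable (measurableSet_normSqBall ι), hpre] at hc
  have h1 := (ENNReal.mul_eq_right (volume_normSqBall_ne_zero ι) (volume_normSqBall_ne_top ι)).mp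
    hc.symm
  rw [h1, one_smul] at hmap
  exact ⟨hL.measurable, hmap⟩

theorem exists_lintegral_normSqBall_eq (n ν : ℕ) :
    ∃ c : ENNReal, c ≠ 0 ∧ c ≠ ⊤ ∧ ∀ (ι : Type) [Fintype ι] (e : Fin n ⊕ Fin (ν + 1) ≃ ι)
      (φ : (Fin n → ℝ) → ENNReal), Measurable φ →
      ∫⁻ g in normSqBall ι, φ (fun k => ‖g (e (.inl k))‖ ^ 2 / ∑ i, ‖g i‖ ^ 2)
      = c * ∫⁻ w in openSimplex n, φ w * ENNReal.ofReal ((1 - ∑ k, w k) ^ ν) := by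
  obtain ⟨c, h0, h1, h⟩ := exists_lintegral_ball_eq_mul_lintegral_simplex n ν
  refine ⟨c, h0, h1, fun ι _ e φ hφ => ?_⟩
  rw [← h φ hφ]
  have hmp := volume_preserving_arrowCongr' e.symm (MeasurableEquiv.refl ℂ)
    (MeasurePreserving.id _)
  have h2 := hmp.setLIntegral_comp_preimage_emb (MeasurableEquiv.measurableEmbedding _)
    (fun g => φ (fun k => ‖g (.inl k)‖ ^ 2 / ∑ i, ‖g i‖ ^ 2)) (normSqBall _)
  have he : ∀ g : ι → ℂ, MeasurableEquiv.arrowCongr' e.symm (MeasurableEquiv.refl ℂ) g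
      = g ∘ e := fun g => rfl
  have hs : ∀ g : ι → ℂ, ∑ i, ‖g (e i)‖ ^ 2 = ∑ i, ‖g i‖ ^ 2 := fun g =>
    Equiv.sum_comp e fun i => ‖g i‖ ^ 2
  have hpre : MeasurableEquiv.arrowCongr' e.symm (MeasurableEquiv.refl ℂ) ⁻¹' normSqBall _
      = normSqBall ι := by
    ext g
    simp only [normSqBall, Set.mem_preimage, he, Set.mem_ofPred_eq, Function.comp_apply, hs]
  rw [hpre] at h2
  simp only [he, Function.comp_apply, hs] at h2
  exact h2

/-- This is a singular value decomposition. If the columns of `R` are the eigenvectors of `B*B`,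
ordered by `σ`, the columns of `BR` divided by `√x_k` are orthonormal and extend to the columns of a
unitary `V`. Then `uBR` has entries `√x_k (uV)_k`, and conjugation by `R` gives `diag(x)` minus a
rank-one matrix. -/
theorem exists_unitary_of_gram {ι : Type} [Fintype ι] [DecidableEq ι] {n ν : ℕ}
    (e : Fin n ⊕ Fin (ν + 1) ≃ ι) (B : Matrix ι (Fin n) ℂ) {x : Fin n → ℝ} (hx : ∀ k, 0 < x k)
    {σ : Equiv.Perm (Fin n)}
    (hσ : (Matrix.isHermitian_conjTranspose_mul_self B).eigenvalues ∘ σ = x) :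
    ∃ (V : Matrix.unitaryGroup ι ℂ), ∀ (u : ι → ℂ), (deflatedGram B u).charpoly =
      (secularPoly x fun k => ‖(u ᵥ* (V : Matrix ι ι ℂ)) (e (.inl k))‖ ^ 2).map
        Complex.ofRealHom := by
  let hH := Matrix.isHermitian_conjTranspose_mul_self B
  let Q : Matrix (Fin n) (Fin n) ℂ := hH.eigenvectorUnitary
  let R : Matrix (Fin n) (Fin n) ℂ := Q.submatrix id σ
  have hR : ∀ M : Matrix (Fin n) (Fin n) ℂ, Rᴴ * M * R = (Qᴴ * M * Q).submatrix σ σ := by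
    intro M
    ext i j
    simp [R, Matrix.mul_apply]
  have hRR : Rᴴ * R = 1 := by
    have h1 : Qᴴ * Q = 1 := Matrix.UnitaryGroup.star_mul_self hH.eigenvectorUnitary
    have h2 := hR 1
    rw [Matrix.mul_one, Matrix.mul_one, h1] at h2
    rw [h2, Matrix.submatrix_one_equiv]
  have hRH : Rᴴ * (Bᴴ * B) * R = Matrix.diagonal fun k => (x k : ℂ) := by
    have h1 := hH.conjStarAlgAut_star_eigenvectorUnitary
    rw [Unitary.conjStarAlgAut_star_apply] at h1
    have h2 : Qᴴ * (Bᴴ * B) * Q = Matrix.diagonal (RCLike.ofReal ∘ hH.eigenvalues) := h1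
    rw [hR, h2, Matrix.submatrix_diagonal_equiv, ← hσ]
    rfl
  have hsq : ∀ k, (√(x k) : ℂ) * √(x k) = x k := fun k => by
    rw [← Complex.ofReal_mul, Real.mul_self_sqrt (hx k).le]
  have hs0 : ∀ k, (√(x k) : ℂ) ≠ 0 := fun k =>
    Complex.ofReal_ne_zero.mpr (Real.sqrt_pos.mpr (hx k)).ne'
  let v : ι → EuclideanSpace ℂ ι := fun i =>
    Sum.elim (fun k => WithLp.toLp 2 fun j => (√(x k) : ℂ)⁻¹ * (B * R) j k) (fun _ => 0) (e.symm i)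
  have hv : Orthonormal ℂ ((Set.range (e ∘ Sum.inl)).domRestrict v) := by
    rw [orthonormal_iff_ite]
    rintro ⟨_, k, rfl⟩ ⟨_, k', rfl⟩
    have h1 : inner ℂ (v (e (.inl k))) (v (e (.inl k')))
        = (√(x k) : ℂ)⁻¹ * (√(x k') : ℂ)⁻¹ * (Rᴴ * (Bᴴ * B) * R) k k' := by
      have : Rᴴ * (Bᴴ * B) * R = (B * R)ᴴ * (B * R) := by
        rw [Matrix.conjTranspose_mul]
        simp only [Matrix.mul_assoc]
      rw [this, Matrix.mul_apply, EuclideanSpace.inner_eq_star_dotProduct, dotProduct,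
        Finset.mul_sum]
      refine Finset.sum_congr rfl fun j _ => ?_
      simp [v]
      ring
    change inner ℂ (v (e (.inl k))) (v (e (.inl k'))) = _
    rw [h1, hRH, Matrix.diagonal_apply]
    by_cases hk : k = k'
    · subst hk
      rw [if_pos rfl, if_pos rfl, ← hsq k]
      have := hs0 k
      field_simp
    · rw [if_neg hk, if_neg, mul_zero]
      simpa using hk
  obtain ⟨b, hb⟩ := hv.exists_orthonormalBasis_extension_of_card_eq (by simp)
  let V : Matrix ι ι ℂ := Matrix.of fun j i => b i j
  have hV : star V * V = 1 := by
    ext i j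
    have := orthonormal_iff_ite.mp b.orthonormal i j
    rw [EuclideanSpace.inner_eq_star_dotProduct, dotProduct] at this
    rw [Matrix.mul_apply, Matrix.one_apply, ← this]
    exact Finset.sum_congr rfl fun k _ => mul_comm _ _
  refine ⟨⟨V, Matrix.mem_unitaryGroup_iff'.mpr hV⟩, fun u => ?_⟩
  have hc : Rᴴ * deflatedGram B u * R = Matrix.diagonal (fun k => (x k : ℂ))
      - Matrix.vecMulVec (star (u ᵥ* (B * R))) (u ᵥ* (B * R)) := by
    rw [deflatedGram, Matrix.mul_sub, Matrix.sub_mul, hRH, Matrix.mul_vecMulVec,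
      Matrix.vecMulVec_mul, ← Matrix.star_vecMul, Matrix.vecMul_vecMul]
  have hch : (deflatedGram B u).charpoly = (Rᴴ * deflatedGram B u * R).charpoly := by
    rw [Matrix.charpoly_mul_comm, ← Matrix.mul_assoc, mul_eq_one_comm.mp hRR, Matrix.one_mul]
  rw [hch, hc]
  refine charpoly_diagonal_sub_vecMulVec fun k => ?_
  have h1 : (u ᵥ* (B * R)) k = √(x k) * (u ᵥ* V) (e (.inl k)) := by
    simp only [Matrix.vecMul, dotProduct, V, Matrix.of_apply, Finset.mul_sum]
    refine Finset.sum_congr rfl fun j _ => ?_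
    have hbk : b (e (.inl k)) = v (e (.inl k)) := hb _ ⟨k, rfl⟩
    rw [hbk]
    have := hs0 k
    simp [v]
    field_simp
  rw [h1, norm_mul, mul_pow, Complex.norm_real, Real.norm_of_nonneg (Real.sqrt_nonneg _),
    Real.sq_sqrt (hx k).le]

/-- The average of `F` over the points interlacing with `x`, with density proportional to
`∏ y_k ^ ν Δ(y)`. -/
noncomputable def interlacingAverage {n : ℕ} (ν : ℕ) (F : (Fin n → ℝ) → ENNReal) (x : Fin n → ℝ) :
    ENNReal :=
  ENNReal.ofReal ((∏ k, x k ^ (ν + 1))⁻¹ * (∏ j : Fin n, ∏ k ∈ Finset.Ioi j, (x k - x j))⁻¹) *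
    ∫⁻ y in {y | Interlaces y x}, F y *
      ENNReal.ofReal ((∏ k, y k ^ ν) * ∏ j : Fin n, ∏ k ∈ Finset.Ioi j, (y k - y j))

/-- A Hermitian matrix with characteristic polynomial `secularPoly x w`. -/
noncomputable def secularMatrix {n : ℕ} (x w : Fin n → ℝ) : Matrix (Fin n) (Fin n) ℂ :=
  Matrix.diagonal (fun k => (x k : ℂ)) -
    Matrix.vecMulVec (star fun k => (√(x k * w k) : ℂ)) fun k => (√(x k * w k) : ℂ)

/-- The row vector `g` scaled to Euclidean norm one. -/
noncomputable def normalizedRow {ι : Type*} [Fintype ι] (g : ι → ℂ) : ι → ℂ :=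
  ((√(∑ i, ‖g i‖ ^ 2))⁻¹ : ℂ) • g

theorem isHermitian_secularMatrix {n : ℕ} (x w : Fin n → ℝ) : (secularMatrix x w).IsHermitian := by
  refine Matrix.IsHermitian.sub ?_ ?_
  · rw [Matrix.isHermitian_diagonal_iff]
    intro k
    exact Complex.conj_ofReal _
  · rw [Matrix.IsHermitian, Matrix.conjTranspose_vecMulVec, star_star]

theorem charpoly_secularMatrix {n : ℕ} {x w : Fin n → ℝ} (hx : ∀ k, 0 < x k) (hw : ∀ k, 0 ≤ w k) :
    (secularMatrix x w).charpoly = (secularPoly x w).map Complex.ofRealHom := by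
  refine charpoly_diagonal_sub_vecMulVec fun k => ?_
  rw [Complex.norm_real, Real.norm_of_nonneg (Real.sqrt_nonneg _),
    Real.sq_sqrt (mul_nonneg (hx k).le (hw k))]

theorem measurable_secularMatrix {n : ℕ} (x : Fin n → ℝ) : Measurable (secularMatrix x) := by
  refine measurable_pi_iff.mpr fun i => measurable_pi_iff.mpr fun j => ?_
  simp only [secularMatrix, Matrix.sub_apply, Matrix.vecMulVec_apply, Pi.star_apply]
  fun_prop

theorem eval_eigenvalues_of_charpoly_eq {n : ℕ} {F : (Fin n → ℝ) → ENNReal}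
    (hs : ∀ (σ : Equiv.Perm (Fin n)) (x : Fin n → ℝ), F (fun i => x (σ i)) = F x)
    {H : Matrix (Fin n) (Fin n) ℂ} (hH : H.IsHermitian) {y : Fin n → ℝ}
    (h : H.charpoly = (∏ j, (Polynomial.X - Polynomial.C (y j))).map Complex.ofRealHom) :
    F hH.eigenvalues = F y := by
  obtain ⟨σ, hσ⟩ := exists_perm_eigenvalues_of_charpoly_eq hH (y := y)
    (by simpa [Polynomial.map_prod] using h)
  rw [← hσ]
  exact hs σ y

theorem norm_sq_normalizedRow_vecMul {ι : Type*} [Fintype ι] [DecidableEq ι] (g : ι → ℂ)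
    (V : Matrix.unitaryGroup ι ℂ) (i : ι) :
    ‖(normalizedRow g ᵥ* (V : Matrix ι ι ℂ)) i‖ ^ 2
      = ‖(g ᵥ* (V : Matrix ι ι ℂ)) i‖ ^ 2 / ∑ i, ‖(g ᵥ* (V : Matrix ι ι ℂ)) i‖ ^ 2 := by
  rw [normalizedRow, Matrix.smul_vecMul, Pi.smul_apply, smul_eq_mul, norm_mul, mul_pow,
    norm_inv, Complex.norm_real, Real.norm_of_nonneg (Real.sqrt_nonneg _), inv_pow,
    Real.sq_sqrt (Finset.sum_nonneg fun _ _ => by positivity), sum_norm_sq_vecMul_unitary V g,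
    inv_mul_eq_div]

theorem sum_norm_sq_normalizedRow {ι : Type*} [Fintype ι] {g : ι → ℂ} (hg : g ≠ 0) :
    ∑ i, ‖normalizedRow g i‖ ^ 2 = 1 := by
  have h0 : 0 < ∑ i, ‖g i‖ ^ 2 := by
    obtain ⟨i, hi⟩ := Function.ne_iff.mp hg
    exact Finset.sum_pos' (fun _ _ => by positivity)
      ⟨i, Finset.mem_univ i, by have := norm_pos_iff.mpr hi; positivity⟩
  simp only [normalizedRow, Pi.smul_apply, smul_eq_mul, norm_mul, mul_pow, ← Finset.mul_sum,
    norm_inv, Complex.norm_real, Real.norm_of_nonneg (Real.sqrt_nonneg _), inv_pow,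
    Real.sq_sqrt h0.le]
  exact inv_mul_cancel₀ h0.ne'

theorem measurable_normalizedRow {ι : Type*} [Fintype ι] :
    Measurable (normalizedRow : (ι → ℂ) → ι → ℂ) := by
  unfold normalizedRow
  fun_prop

/-- For fixed `B`, the row `gV` is again uniform in the ball, so the secular weights are Dirichlet
and the substitution from weights to roots yields the interlacing average. -/
theorem exists_lintegral_deflatedGram_eq (n ν : ℕ) :
    ∃ c : ENNReal, c ≠ 0 ∧ c ≠ ⊤ ∧ ∀ (ι : Type) [Fintype ι] (_ : Fin n ⊕ Fin (ν + 1) ≃ ι)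
      (F : (Fin n → ℝ) → ENNReal), Measurable F →
      (∀ (σ : Equiv.Perm (Fin n)) (x : Fin n → ℝ), F (fun i => x (σ i)) = F x) →
      ∀ (B : Matrix ι (Fin n) ℂ) (σ : Equiv.Perm (Fin n)),
      (Matrix.isHermitian_conjTranspose_mul_self B).eigenvalues ∘ σ ∈ chamber n →
      ∫⁻ g in normSqBall ι, F (isHermitian_deflatedGram B (normalizedRow g)).eigenvalues
      = c * interlacingAverage ν F
        ((Matrix.isHermitian_conjTranspose_mul_self B).eigenvalues ∘ σ) := by
  obtain ⟨c, h0, h1, h⟩ := exists_lintegral_normSqBall_eq n ν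
  refine ⟨c, h0, h1, fun ι _ e F hF hs B σ hσ => ?_⟩
  classical
  obtain ⟨V, hV⟩ := exists_unitary_of_gram e B hσ.2 rfl
  set x := (Matrix.isHermitian_conjTranspose_mul_self B).eigenvalues ∘ σ with hx
  -- The roots of the secular polynomial are realised as eigenvalues of an explicit Hermitian
  -- matrix, which makes them measurable functions of the weights.
  let φ : (Fin n → ℝ) → ENNReal := fun w => F (isHermitian_secularMatrix x w).eigenvalues
  have hφ : Measurable φ :=
    hF.comp (measurable_eigenvalues (isHermitian_secularMatrix x) (measurable_secularMatrix x))
  let w : (ι → ℂ) → Fin n → ℝ := fun g k => ‖g (e (.inl k))‖ ^ 2 / ∑ i, ‖g i‖ ^ 2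
  have hw : Measurable w := by
    refine measurable_pi_iff.mpr fun k => ?_
    fun_prop
  have e1 : ∀ g : ι → ℂ, F (isHermitian_deflatedGram B (normalizedRow g)).eigenvalues
      = φ (w (g ᵥ* (V : Matrix ι ι ℂ))) := by
    intro g
    refine congrArg F ((Matrix.IsHermitian.eigenvalues_eq_eigenvalues_iff _ _).mpr ?_)
    rw [hV, charpoly_secularMatrix hσ.2 fun k => by positivity]
    congr 2
    funext k
    exact norm_sq_normalizedRow_vecMul g V _
  have hmp := measurePreserving_vecMul_unitary V
  have hpre : (fun g : ι → ℂ => g ᵥ* (V : Matrix ι ι ℂ)) ⁻¹' normSqBall ι = normSqBall ι := by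
    ext g
    simp only [normSqBall, Set.mem_preimage, Set.mem_ofPred_eq, sum_norm_sq_vecMul_unitary]
  simp_rw [e1]
  have e2 := hmp.setLIntegral_comp_preimage (measurableSet_normSqBall ι) (hφ.comp hw)
  rw [hpre] at e2
  refine e2.trans ((h ι e φ hφ).trans ?_)
  rw [lintegral_simplex_eq_lintegral_interlaces hσ, interlacingAverage]
  congr 2
  refine setLIntegral_congr_fun ((measurableSet_interlaces n).preimage measurable_prodMk_right)
    fun y hy => ?_
  congr 1
  refine eval_eigenvalues_of_charpoly_eq hs _ ?_
  rw [charpoly_secularMatrix hσ.2 fun k => ((weightMap_mem_openSimplex hy).1 k).le,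
    secularPoly_weightMap hσ]

/-- Every unit row is `e_{i₀} V` for some unitary `V`, and deflating `VB` along `e_{i₀}` is
deflating `B` along `e_{i₀} V`. By invariance all directions give the same integral, so it may be
averaged over the ball and the order of integration exchanged. -/
theorem lintegral_deflatedGram_single {ι : Type} [Fintype ι] [DecidableEq ι] {n : ℕ} (i₀ : ι)
    (ρ : Measure (Matrix ι (Fin n) ℂ)) [SFinite ρ]
    (hρ : ∀ V : Matrix.unitaryGroup ι ℂ, ρ.map (fun B => (V : Matrix ι ι ℂ) * B) = ρ)
    {F : (Fin n → ℝ) → ENNReal} (hF : Measurable F) :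
    volume (normSqBall ι) *
      ∫⁻ B, F (isHermitian_deflatedGram B (Pi.single i₀ 1)).eigenvalues ∂ρ
    = ∫⁻ B, (∫⁻ g in normSqBall ι,
        F (isHermitian_deflatedGram B (normalizedRow g)).eigenvalues) ∂ρ := by
  have hm : ∀ {α : Type} [MeasurableSpace α] {B : α → Matrix ι (Fin n) ℂ} {u : α → ι → ℂ},
      Measurable B → Measurable u →
      Measurable fun a => F (isHermitian_deflatedGram (B a) (u a)).eigenvalues := by
    intro α _ B u hB hu
    exact hF.comp (measurable_eigenvalues (fun a => isHermitian_deflatedGram (B a) (u a))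
      (measurable_deflatedGram hB hu))
  have hmul : ∀ V : Matrix.unitaryGroup ι ℂ,
      Measurable fun B : Matrix ι (Fin n) ℂ => (V : Matrix ι ι ℂ) * B := fun V =>
    (by fun_prop : Continuous fun B : Matrix ι (Fin n) ℂ => (V : Matrix ι ι ℂ) * B).measurable
  have h1 : ∀ u : ι → ℂ, ∑ i, ‖u i‖ ^ 2 = 1 →
      ∫⁻ B, F (isHermitian_deflatedGram B u).eigenvalues ∂ρ
        = ∫⁻ B, F (isHermitian_deflatedGram B (Pi.single i₀ 1)).eigenvalues ∂ρ := by
    intro u hu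
    obtain ⟨V, hV⟩ := exists_unitary_row_eq i₀ hu
    conv_rhs => rw [← hρ V]
    rw [lintegral_map (hm measurable_id measurable_const) (hmul V)]
    refine lintegral_congr fun B => congrArg F (eigenvalues_congr ?_ _ _)
    rw [id, deflatedGram_mul, hV]
  rw [lintegral_lintegral_swap (hm measurable_fst
    (measurable_normalizedRow.comp measurable_snd)).aemeasurable]
  have h2 : ∀ᵐ g ∂(volume.restrict (normSqBall ι)),
      ∫⁻ B, F (isHermitian_deflatedGram B (normalizedRow g)).eigenvalues ∂ρ
        = ∫⁻ B, F (isHermitian_deflatedGram B (Pi.single i₀ 1)).eigenvalues ∂ρ := by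
    refine ae_restrict_of_ae ?_
    have : Nonempty ι := ⟨i₀⟩
    filter_upwards [Measure.ae_ne volume (0 : ι → ℂ)] with g hg
    exact h1 _ (sum_norm_sq_normalizedRow hg)
  rw [lintegral_congr_ae h2, lintegral_const, Measure.restrict_apply_univ, mul_comm]

theorem exists_lintegral_deflatedGram_single_eq (n ν : ℕ) :
    ∃ c : ENNReal, c ≠ 0 ∧ c ≠ ⊤ ∧ ∀ (ι : Type) [Fintype ι] [DecidableEq ι]
      (_ : Fin n ⊕ Fin (ν + 1) ≃ ι) (i₀ : ι) (ρ : Measure (Matrix ι (Fin n) ℂ)) [SFinite ρ],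
      (∀ V : Matrix.unitaryGroup ι ℂ, ρ.map (fun B => (V : Matrix ι ι ℂ) * B) = ρ) →
      (∀ᵐ B ∂ρ, ∃ σ : Equiv.Perm (Fin n),
        (Matrix.isHermitian_conjTranspose_mul_self B).eigenvalues ∘ σ ∈ chamber n) →
      ∀ F : (Fin n → ℝ) → ENNReal, Measurable F →
      (∀ (σ : Equiv.Perm (Fin n)) (x : Fin n → ℝ), F (fun i => x (σ i)) = F x) →
      volume (normSqBall ι) *
        ∫⁻ B, F (isHermitian_deflatedGram B (Pi.single i₀ 1)).eigenvalues ∂ρ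
      = c * ∫⁻ B, symmetrize (interlacingAverage ν F)
        (Matrix.isHermitian_conjTranspose_mul_self B).eigenvalues ∂ρ := by
  obtain ⟨c, h0, h1, h⟩ := exists_lintegral_deflatedGram_eq n ν
  refine ⟨c, h0, h1, fun ι _ _ e i₀ ρ _ hρ hch F hF hs => ?_⟩
  rw [lintegral_deflatedGram_single i₀ ρ hρ hF, ← lintegral_const_mul' _ _ h1]
  refine lintegral_congr_ae ?_
  filter_upwards [hch] with B ⟨σ, hσ⟩
  rw [h ι e F hF hs B σ hσ, symmetrize_of_mem _ hσ]

/-! ### Integrating determinants over interlacing points -/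

/-- The points above `y j` and below all `y k` with `j < k`. -/
def gapAbove {n : ℕ} (y : Fin n → ℝ) (j : Fin n) : Set ℝ := {t | y j < t ∧ ∀ k, j < k → t < y k}

theorem gapAbove_subset_Ioi {n : ℕ} (y : Fin n → ℝ) (j : Fin n) :
    gapAbove y j ⊆ Set.Ioi (y j) := fun _ h => h.1

theorem measurableSet_gapAbove {n : ℕ} (y : Fin n → ℝ) (j : Fin n) :
    MeasurableSet (gapAbove y j) := by
  have : gapAbove y j = Set.Ioi (y j) ∩ ⋂ k, ⋂ (_ : j < k), Set.Iio (y k) := by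
    ext t
    simp [gapAbove]
  rw [this]
  exact measurableSet_Ioi.inter
    (MeasurableSet.iInter fun k => MeasurableSet.iInter fun _ => measurableSet_Iio)

theorem setOf_interlaces_eq_pi {n : ℕ} {y : Fin n → ℝ} (hy : ∀ k, 0 < y k) :
    {x | Interlaces y x} = Set.univ.pi (gapAbove y) := by
  ext x
  simp only [Interlaces, Set.mem_ofPred_eq, Set.mem_univ_pi, gapAbove]
  exact ⟨fun h j => ⟨h.2.1 j, h.2.2 j⟩, fun h => ⟨hy, fun k => (h k).1, fun j k => (h j).2 k⟩⟩

/-- In the Leibniz expansion each term is a product of one-variable functions, so the integral over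
a box factors. -/
theorem integral_det_pi {n : ℕ} {h : Fin n → ℝ → ℝ} {s : Fin n → Set ℝ}
    (hi : ∀ j k, IntegrableOn (h k) (s j)) :
    IntegrableOn (fun x : Fin n → ℝ => (Matrix.of fun j k => h k (x j)).det) (Set.univ.pi s) ∧
    ∫ x in Set.univ.pi s, (Matrix.of fun j k => h k (x j)).det
      = (Matrix.of fun j k => ∫ t in s j, h k t).det := by
  have hm : (volume : Measure (Fin n → ℝ)).restrict (Set.univ.pi s)
      = Measure.pi fun j => volume.restrict (s j) := by
    rw [volume_pi, Measure.restrict_pi_pi]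
  have hdet : ∀ M : Matrix (Fin n) (Fin n) ℝ, M.det
      = ∑ σ : Equiv.Perm (Fin n), ((Equiv.Perm.sign σ : ℤ) : ℝ) * ∏ i, M i (σ i) := by
    intro M
    rw [← Matrix.det_transpose, Matrix.det_apply']
    rfl
  have hint : ∀ σ : Equiv.Perm (Fin n), Integrable
      (fun x : Fin n → ℝ => ((Equiv.Perm.sign σ : ℤ) : ℝ) * ∏ j, h (σ j) (x j))
      (Measure.pi fun j => volume.restrict (s j)) := fun σ =>
    (Integrable.fintype_prod (f := fun j t => h (σ j) t) fun j => hi j (σ j)).const_mul _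
  simp only [IntegrableOn, hm, hdet, Matrix.of_apply]
  refine ⟨integrable_finsetSum _ fun σ _ => hint σ, ?_⟩
  rw [integral_finsetSum _ fun σ _ => hint σ]
  refine Finset.sum_congr rfl fun σ _ => ?_
  rw [integral_const_mul, integral_fintype_prod_eq_prod (fun j t => h (σ j) t)]

theorem Ioi_ae_eq_iUnion_gapAbove {n : ℕ} {y : Fin n → ℝ} (hy : StrictMono y) (j : Fin n) :
    Set.Ioi (y j) =ᵐ[volume] ⋃ i ∈ Finset.Ici j, gapAbove y i := by
  rw [Filter.eventuallyEq_set]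
  have hne : ∀ᵐ t : ℝ ∂volume, ∀ i, t ≠ y i := by
    rw [ae_all_iff]
    exact fun i => Measure.ae_ne volume (y i)
  filter_upwards [hne] with t ht
  simp only [Set.mem_Ioi, Set.mem_iUnion, Finset.mem_Ici, exists_prop]
  constructor
  · intro hjt
    let s : Finset (Fin n) := Finset.univ.filter fun i => y i < t
    have hs : s.Nonempty := ⟨j, by simpa [s] using hjt⟩
    have hmax := s.max'_mem hs
    refine ⟨s.max' hs, s.le_max' j (by simpa [s] using hjt), by simpa [s] using hmax, ?_⟩
    intro k hk
    by_contra hc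
    have : k ∈ s := by
      simpa [s] using lt_of_le_of_ne (not_lt.mp hc) (ht k).symm
    exact absurd (s.le_max' k this) (not_le.mpr hk)
  · rintro ⟨i, hji, hi⟩
    exact (hy.monotone hji).trans_lt hi.1

theorem integral_Ioi_eq_sum_gapAbove {n : ℕ} {y : Fin n → ℝ} (hy : StrictMono y) {h : ℝ → ℝ}
    (hi : ∀ j, IntegrableOn h (Set.Ioi (y j))) (j : Fin n) :
    ∫ t in Set.Ioi (y j), h t = ∑ i ∈ Finset.Ici j, ∫ t in gapAbove y i, h t := by
  rw [setIntegral_congr_set (Ioi_ae_eq_iUnion_gapAbove hy j)]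
  refine integral_biUnion_finset _ (fun i _ => measurableSet_gapAbove y i) ?_
    fun i _ => (hi i).mono_set (gapAbove_subset_Ioi y i)
  intro i _ i' _ hne
  refine Set.disjoint_left.mpr fun t h1 h2 => ?_
  rcases lt_or_gt_of_ne hne with hlt | hlt
  · exact lt_asymm (h1.2 i' hlt) h2.1
  · exact lt_asymm (h2.2 i hlt) h1.1

/-- The half-line above `y_j` is, up to finitely many points, the union of the gaps with index `i ≥
j`, so the two matrices differ by an upper unitriangular factor. -/
theorem det_integral_gapAbove {n : ℕ} {y : Fin n → ℝ} (hy : StrictMono y) {h : Fin n → ℝ → ℝ}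
    (hi : ∀ j k, IntegrableOn (h k) (Set.Ioi (y j))) :
    (Matrix.of fun j k => ∫ t in gapAbove y j, h k t).det
      = (Matrix.of fun j k => ∫ t in Set.Ioi (y j), h k t).det := by
  let U : Matrix (Fin n) (Fin n) ℝ := Matrix.of fun j i => if j ≤ i then 1 else 0
  have hU : U.det = 1 := by
    rw [Matrix.det_of_isUpperTriangular]
    · simp [U]
    · intro i j hij
      simpa [U] using hij
  have : (Matrix.of fun j k => ∫ t in Set.Ioi (y j), h k t)
      = U * Matrix.of fun j k => ∫ t in gapAbove y j, h k t := by
    ext j k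
    rw [Matrix.of_apply, integral_Ioi_eq_sum_gapAbove hy (fun j => hi j k), Matrix.mul_apply]
    simp only [U, Matrix.of_apply, ite_mul, one_mul, zero_mul, ← Finset.sum_filter]
    congr 1
    ext i
    simp
  rw [this, Matrix.det_mul, hU, one_mul]

theorem integral_det_interlaces {n : ℕ} {y : Fin n → ℝ} (hy : y ∈ chamber n) {h : Fin n → ℝ → ℝ}
    (hi : ∀ j k, IntegrableOn (h k) (Set.Ioi (y j))) :
    IntegrableOn (fun x : Fin n → ℝ => (Matrix.of fun j k => h k (x j)).det)
      {x | Interlaces y x} ∧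
    ∫ x in {x | Interlaces y x}, (Matrix.of fun j k => h k (x j)).det
      = (Matrix.of fun j k => ∫ t in Set.Ioi (y j), h k t).det := by
  have h1 := integral_det_pi (h := h) (s := gapAbove y) fun j k =>
    (hi j k).mono_set (gapAbove_subset_Ioi y j)
  rw [setOf_interlaces_eq_pi hy.2]
  exact ⟨h1.1, h1.2.trans (det_integral_gapAbove hy.1 hi)⟩

/-! ### The one-row transform on functions and on densities -/

/-- The transform `∫_0^1 x ^ ν (1 - x) ^ p f (y / x) dx / x`, after the substitution `t = y / x`. -/
noncomputable def truncationTransform (ν p : ℕ) (f : ℝ → ℝ) (y : ℝ) : ℝ :=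
  y ^ ν * ∫ t in Set.Ioi y, (t - y) ^ p * (t ^ (ν + p + 1))⁻¹ * f t

theorem integrableOn_Ioi_inv_pow_mul {f : ℝ → ℝ} (hf : IntegrableOn f (Set.Ioi 0)) (q : ℕ) {y : ℝ}
    (hy : 0 < y) : IntegrableOn (fun t => (t ^ q)⁻¹ * f t) (Set.Ioi y) := by
  refine (hf.mono_set (Set.Ioi_subset_Ioi hy.le)).bdd_mul (c := (y ^ q)⁻¹)
    (by fun_prop) ?_
  filter_upwards [ae_restrict_mem measurableSet_Ioi] with t ht
  have ht' : y < t := ht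
  rw [Real.norm_of_nonneg (by have := hy.trans ht'; positivity)]
  gcongr

/-- By Tonelli, integrating `y^(j+ν)` over `(0, t)` gives `t^(j+ν+1) / (j+ν+1)`, which cancels
`t^(-ν-1)` and leaves the `j`-th moment of `|f|`. -/
theorem integrableOn_pow_mul_truncationTransform {f : ℝ → ℝ} (hf : IntegrableOn f (Set.Ioi 0))
    {j : ℕ} (hj : IntegrableOn (fun x => x ^ j * f x) (Set.Ioi 0)) (ν : ℕ) :
    IntegrableOn (fun y => y ^ j * truncationTransform ν 0 f y) (Set.Ioi 0) := by
  let h : ℝ → ℝ := (Set.Ioi 0).indicator fun t => (t ^ (ν + 1))⁻¹ * f t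
  have hh : AEStronglyMeasurable h volume := by
    refine (aestronglyMeasurable_indicator_iff measurableSet_Ioi).mpr ?_
    exact AEStronglyMeasurable.mul (by fun_prop) hf.aestronglyMeasurable
  let J : ℝ × ℝ → ℝ := {z : ℝ × ℝ | 0 < z.1 ∧ z.1 < z.2}.indicator
    fun z => z.1 ^ (j + ν) * h z.2
  have hms : MeasurableSet {z : ℝ × ℝ | 0 < z.1 ∧ z.1 < z.2} :=
    (measurableSet_lt measurable_const measurable_fst).inter
      (measurableSet_lt measurable_fst measurable_snd)
  have hJm : AEStronglyMeasurable J (volume.prod volume) := by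
    refine AEStronglyMeasurable.indicator ?_ hms
    exact AEStronglyMeasurable.mul (by fun_prop) hh.comp_snd
  have hslice : ∀ t, (fun y => J (y, t)) = (Set.Ioo 0 t).indicator fun y => y ^ (j + ν) * h t := by
    intro t
    ext y
    simp [J, Set.indicator_apply]
  have hJ : Integrable J (volume.prod volume) := by
    rw [integrable_prod_iff' hJm]
    constructor
    · refine Filter.Eventually.of_forall fun t => ?_
      rw [hslice, integrable_indicator_iff measurableSet_Ioo]
      exact ((by fun_prop : Continuous fun y : ℝ => y ^ (j + ν) * h t).integrableOn_Icc
        (a := 0) (b := t)).mono_set Set.Ioo_subset_Icc_self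
    · have h1 : ∀ t, ∫ y, ‖J (y, t)‖
          = (Set.Ioi 0).indicator (fun t => ‖t ^ j * f t‖ / (j + ν + 1)) t := by
        intro t
        have : ∀ y, ‖J (y, t)‖ = (Set.Ioo 0 t).indicator (fun y => y ^ (j + ν) * ‖h t‖) y := by
          intro y
          have h2 : J (y, t) = (Set.Ioo 0 t).indicator (fun y => y ^ (j + ν) * h t) y :=
            congrFun (hslice t) y
          by_cases hy : y ∈ Set.Ioo 0 t
          · have := hy.1.le
            rw [h2, Set.indicator_of_mem hy, Set.indicator_of_mem hy, norm_mul,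
              Real.norm_of_nonneg (by positivity)]
          · rw [h2, Set.indicator_of_notMem hy, Set.indicator_of_notMem hy, norm_zero]
        simp_rw [this]
        rw [integral_indicator measurableSet_Ioo]
        by_cases ht : 0 < t
        · rw [Set.indicator_of_mem (by exact ht), integral_mul_const,
            ← integral_Ioc_eq_integral_Ioo, ← intervalIntegral.integral_of_le ht.le, integral_pow]
          simp only [h, Set.indicator_of_mem (show t ∈ Set.Ioi 0 from ht), norm_mul, norm_inv,
            norm_pow, Real.norm_of_nonneg ht.le]
          push_cast
          rw [pow_succ, pow_add, pow_succ]
          field_simp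
          simp
          exact Or.inl (by ring)
        · rw [Set.indicator_of_notMem (by exact ht), Set.Ioo_eq_empty ht]
          simp
      simp_rw [h1]
      rw [integrable_indicator_iff measurableSet_Ioi]
      exact hj.norm.div_const _
  have h2 := hJ.integral_prod_left
  rw [← integrable_indicator_iff measurableSet_Ioi]
  refine h2.congr (Filter.Eventually.of_forall fun y => ?_)
  simp only
  by_cases hy : 0 < y
  · rw [Set.indicator_of_mem (by exact hy), truncationTransform, ← mul_assoc, ← pow_add,
      ← integral_const_mul, ← integral_indicator measurableSet_Ioi]
    congr 1
    ext t
    by_cases hyt : y < t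
    · have := hy.trans hyt
      simp [J, h, Set.indicator_apply, hy, hyt, this]
    · simp [J, hyt]
  · rw [Set.indicator_of_notMem (by exact hy)]
    simp [J, hy]

theorem measurableSet_interlaces_left {n : ℕ} (x : Fin n → ℝ) :
    MeasurableSet {y | Interlaces y x} :=
  (measurableSet_interlaces n).preimage measurable_prodMk_right

theorem measurableSet_interlaces_right {n : ℕ} (y : Fin n → ℝ) :
    MeasurableSet {x | Interlaces y x} :=
  (measurableSet_interlaces n).preimage measurable_prodMk_left

theorem measurable_interlacingAverage {n : ℕ} (ν : ℕ) {F : (Fin n → ℝ) → ENNReal}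
    (hF : Measurable F) : Measurable (interlacingAverage ν F) := by
  unfold interlacingAverage
  refine Measurable.mul (by fun_prop) ?_
  have : ∀ x : Fin n → ℝ, ∫⁻ y in {y | Interlaces y x}, F y *
      ENNReal.ofReal ((∏ k, y k ^ ν) * ∏ j : Fin n, ∏ k ∈ Finset.Ioi j, (y k - y j))
      = ∫⁻ y, {z : (Fin n → ℝ) × (Fin n → ℝ) | Interlaces z.2 z.1}.indicator (fun z => F z.2 *
        ENNReal.ofReal ((∏ k, z.2 k ^ ν) * ∏ j : Fin n, ∏ k ∈ Finset.Ioi j, (z.2 k - z.2 j)))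
        (x, y) := by
    intro x
    rw [← lintegral_indicator (measurableSet_interlaces_left x)]
    rfl
  simp_rw [this]
  refine Measurable.lintegral_prod_right' (Measurable.indicator (by fun_prop)
    ((measurableSet_interlaces n).preimage measurable_swap))

theorem vandermondeTimesDet_truncationTransform {n : ℕ} (ν : ℕ) (f : Fin n → ℝ → ℝ)
    (y : Fin n → ℝ) :
    vandermondeTimesDet (fun k => truncationTransform ν 0 (f k)) y
      = ((∏ k, y k ^ ν) * ∏ j : Fin n, ∏ k ∈ Finset.Ioi j, (y k - y j)) *
        (Matrix.of fun j k : Fin n => ∫ t in Set.Ioi (y j), (t ^ (ν + 1))⁻¹ * f k t).det := by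
  have h : (Matrix.of fun j k : Fin n => truncationTransform ν 0 (f k) (y j))
      = Matrix.of fun j k => y j ^ ν *
        (Matrix.of fun j k : Fin n => ∫ t in Set.Ioi (y j), (t ^ (ν + 1))⁻¹ * f k t) j k := by
    ext j k
    simp [truncationTransform]
  rw [vandermondeTimesDet, h, Matrix.det_mul_column]
  ring

theorem det_inv_pow_mul {n : ℕ} (ν : ℕ) (f : Fin n → ℝ → ℝ) (x : Fin n → ℝ) :
    (Matrix.of fun j k : Fin n => (x j ^ (ν + 1))⁻¹ * f k (x j)).det
      = (∏ k, x k ^ (ν + 1))⁻¹ * (Matrix.of fun j k : Fin n => f k (x j)).det := by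
  rw [← Finset.prod_inv_distrib]
  exact Matrix.det_mul_column (fun j => (x j ^ (ν + 1))⁻¹) (Matrix.of fun j k => f k (x j))

theorem mul_det_nonneg_of_vandermondeTimesDet {n : ℕ} {Z : ℝ} {f : Fin n → ℝ → ℝ} {x : Fin n → ℝ}
    (hx : StrictMono x) (h : 0 ≤ Z * vandermondeTimesDet f x) :
    0 ≤ Z * (Matrix.of fun j k : Fin n => f k (x j)).det := by
  rw [vandermondeTimesDet, mul_left_comm] at h
  exact nonneg_of_mul_nonneg_right h (vandermonde_pos hx)

section

variable {n : ℕ} (ν : ℕ) {f : Fin n → ℝ → ℝ} {Z : ℝ}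

theorem integral_det_interlaces_eq (hf : ∀ k, IntegrableOn (f k) (Set.Ioi 0))
    {y : Fin n → ℝ} (hy : y ∈ chamber n) (Z : ℝ) :
    IntegrableOn (fun x : Fin n → ℝ =>
      Z * (Matrix.of fun j k : Fin n => (x j ^ (ν + 1))⁻¹ * f k (x j)).det)
      {x | Interlaces y x} ∧
    ∫ x in {x | Interlaces y x},
        Z * (Matrix.of fun j k : Fin n => (x j ^ (ν + 1))⁻¹ * f k (x j)).det
      = Z * (Matrix.of fun j k : Fin n => ∫ t in Set.Ioi (y j), (t ^ (ν + 1))⁻¹ * f k t).det := by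
  have h := integral_det_interlaces (h := fun k t => (t ^ (ν + 1))⁻¹ * f k t) hy
    fun j k => integrableOn_Ioi_inv_pow_mul (hf k) (ν + 1) (hy.2 j)
  exact ⟨h.1.const_mul Z, by rw [integral_const_mul, h.2]⟩

theorem mul_det_inv_pow_nonneg
    (hpos : ∀ x : Fin n → ℝ, (∀ j, 0 < x j) → 0 ≤ Z * vandermondeTimesDet f x) {x : Fin n → ℝ}
    (hx : x ∈ chamber n) :
    0 ≤ Z * (Matrix.of fun j k : Fin n => (x j ^ (ν + 1))⁻¹ * f k (x j)).det := by
  rw [det_inv_pow_mul, mul_left_comm]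
  refine mul_nonneg ?_ (mul_det_nonneg_of_vandermondeTimesDet hx.1 (hpos x hx.2))
  exact inv_nonneg.mpr (Finset.prod_nonneg fun k _ => pow_nonneg (hx.2 k).le _)

theorem mul_det_integral_nonneg (hf : ∀ k, IntegrableOn (f k) (Set.Ioi 0))
    (hpos : ∀ x : Fin n → ℝ, (∀ j, 0 < x j) → 0 ≤ Z * vandermondeTimesDet f x) {y : Fin n → ℝ}
    (hy : y ∈ chamber n) :
    0 ≤ Z * (Matrix.of fun j k : Fin n =>
      ∫ t in Set.Ioi (y j), (t ^ (ν + 1))⁻¹ * f k t).det := by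
  rw [← (integral_det_interlaces_eq ν hf hy Z).2]
  refine setIntegral_nonneg (measurableSet_interlaces_right y)
    fun x hx => mul_det_inv_pow_nonneg ν hpos (Interlaces.right_mem_chamber hx)

/-- Distinct points can be sorted into the chamber, where the determinant is an integral of a
nonnegative function; at coinciding points the Vandermonde factor vanishes. -/
theorem mul_vandermondeTimesDet_truncationTransform_nonneg
    (hf : ∀ k, IntegrableOn (f k) (Set.Ioi 0))
    (hpos : ∀ x : Fin n → ℝ, (∀ j, 0 < x j) → 0 ≤ Z * vandermondeTimesDet f x) {y : Fin n → ℝ}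
    (hy : ∀ j, 0 < y j) :
    0 ≤ Z * vandermondeTimesDet (fun k => truncationTransform ν 0 (f k)) y := by
  by_cases hinj : Function.Injective y
  · obtain ⟨σ, hσ⟩ := exists_perm_comp_mem_chamber hinj hy
    rw [← vandermondeTimesDet_comp_perm _ σ, vandermondeTimesDet_truncationTransform, mul_left_comm]
    exact mul_nonneg (mul_nonneg (Finset.prod_nonneg fun k _ => pow_nonneg (hσ.2 k).le _)
      (vandermonde_pos hσ.1).le) (mul_det_integral_nonneg ν hf hpos hσ)
  · rw [vandermondeTimesDet_of_not_injective _ hinj, mul_zero]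

theorem aemeasurable_mul_det_indicator (hf : ∀ k, IntegrableOn (f k) (Set.Ioi 0)) (Z : ℝ) :
    AEMeasurable (fun x : Fin n → ℝ => ENNReal.ofReal (Z *
      (Matrix.of fun j k : Fin n => (x j ^ (ν + 1))⁻¹ * (Set.Ioi 0).indicator (f k) (x j)).det))
      volume := by
  have h : ∀ j k : Fin n, AEMeasurable
      (fun x : Fin n → ℝ => (x j ^ (ν + 1))⁻¹ * (Set.Ioi 0).indicator (f k) (x j)) volume := by
    intro j k
    have h1 : AEMeasurable ((Set.Ioi 0).indicator (f k)) volume :=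
      (aemeasurable_indicator_iff measurableSet_Ioi).mpr (hf k).aemeasurable
    refine AEMeasurable.mul (f := fun x : Fin n → ℝ => (x j ^ (ν + 1))⁻¹)
      (Measurable.aemeasurable (by fun_prop)) (h1.comp_quasiMeasurePreserving
      (Measure.quasiMeasurePreserving_eval (fun _ : Fin n => (volume : Measure ℝ)) j))
  simp only [Matrix.det_apply', Matrix.of_apply]
  refine (AEMeasurable.const_mul ?_ _).ennreal_ofReal
  refine Finset.aemeasurable_fun_sum _ fun σ _ => AEMeasurable.const_mul ?_ _
  exact Finset.aemeasurable_fun_prod _ fun i _ => h _ _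

/-- The average divides by `Δ(x)`, which cancels the Vandermonde factor of the density. After
Tonelli the inner integral over `x` is a determinant of half-line integrals, and the factors `∏
y_k^ν Δ(y)` restore the polynomial ensemble form. -/
theorem lintegral_interlacingAverage (hf : ∀ k, IntegrableOn (f k) (Set.Ioi 0))
    (hpos : ∀ x : Fin n → ℝ, (∀ j, 0 < x j) → 0 ≤ Z * vandermondeTimesDet f x)
    {F : (Fin n → ℝ) → ENNReal} (hF : Measurable F) :
    ∫⁻ x in chamber n, interlacingAverage ν F x * ENNReal.ofReal (Z * vandermondeTimesDet f x)
      = ∫⁻ y in chamber n, F y * ENNReal.ofReal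
        (Z * vandermondeTimesDet (fun k => truncationTransform ν 0 (f k)) y) := by
  let W : (Fin n → ℝ) → ENNReal := fun y => F y *
    ENNReal.ofReal ((∏ k, y k ^ ν) * ∏ j : Fin n, ∏ k ∈ Finset.Ioi j, (y k - y j))
  have hW : Measurable W := by fun_prop
  -- Cutting the `f_k` off outside `(0,∞)` makes them a.e. measurable on the whole line without
  -- changing anything on the chamber.
  let D : (Fin n → ℝ) → ENNReal := fun x => ENNReal.ofReal (Z *
    (Matrix.of fun j k : Fin n => (x j ^ (ν + 1))⁻¹ * (Set.Ioi 0).indicator (f k) (x j)).det)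
  have hD : AEMeasurable D volume := aemeasurable_mul_det_indicator ν hf Z
  have hDx : ∀ x ∈ chamber n, D x = ENNReal.ofReal (Z *
      (Matrix.of fun j k : Fin n => (x j ^ (ν + 1))⁻¹ * f k (x j)).det) := by
    intro x hx
    simp only [D, Set.indicator_of_mem (show x _ ∈ Set.Ioi 0 from hx.2 _)]
  let J : (Fin n → ℝ) → (Fin n → ℝ) → ENNReal := fun x y =>
    {z : (Fin n → ℝ) × (Fin n → ℝ) | Interlaces z.2 z.1}.indicator (fun z => W z.2 * D z.1) (x, y)
  have hJ : AEMeasurable (Function.uncurry J) (volume.prod volume) := by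
    refine AEMeasurable.indicator ?_ ((measurableSet_interlaces n).preimage measurable_swap)
    exact (hW.comp measurable_snd).aemeasurable.mul hD.comp_fst
  have hJ0 : ∀ x y, ¬ Interlaces y x → J x y = 0 := fun x y h =>
    Set.indicator_of_notMem (s := {z : (Fin n → ℝ) × (Fin n → ℝ) | Interlaces z.2 z.1}) h _
  have h1 : ∫⁻ x in chamber n, interlacingAverage ν F x * ENNReal.ofReal
      (Z * vandermondeTimesDet f x) = ∫⁻ x, ∫⁻ y, J x y := by
    rw [← lintegral_indicator (measurableSet_chamber n)]
    refine lintegral_congr fun x => ?_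
    by_cases hx : x ∈ chamber n
    · have hV := vandermonde_pos hx.1
      have hP : 0 < ∏ k, x k ^ (ν + 1) := Finset.prod_pos fun k _ => pow_pos (hx.2 k) _
      rw [Set.indicator_of_mem hx, interlacingAverage, mul_right_comm,
        ← ENNReal.ofReal_mul (by positivity)]
      have e1 : (∏ k, x k ^ (ν + 1))⁻¹ * (∏ j : Fin n, ∏ k ∈ Finset.Ioi j, (x k - x j))⁻¹ *
          (Z * vandermondeTimesDet f x)
          = Z * (Matrix.of fun j k : Fin n => (x j ^ (ν + 1))⁻¹ * f k (x j)).det := by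
        rw [det_inv_pow_mul, vandermondeTimesDet]
        field_simp
      rw [e1, ← hDx x hx, mul_comm, ← lintegral_mul_const _ hW,
        ← lintegral_indicator (measurableSet_interlaces_left x)]
      rfl
    · simp [Set.indicator_of_notMem hx, fun y => hJ0 x y fun h => hx h.right_mem_chamber]
  rw [h1, lintegral_lintegral_swap hJ, ← lintegral_indicator (measurableSet_chamber n)]
  refine lintegral_congr fun y => ?_
  by_cases hy : y ∈ chamber n
  · have e2 : ∫⁻ x, J x y = W y * ∫⁻ x in {x | Interlaces y x}, D x := by
      rw [← lintegral_const_mul'' _ hD.restrict, ← lintegral_indicator (measurableSet_interlaces_right y)]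
      rfl
    rw [e2, setLIntegral_congr_fun (measurableSet_interlaces_right y) fun x hx => hDx x (Interlaces.right_mem_chamber hx),
      ← ofReal_integral_eq_lintegral_ofReal (integral_det_interlaces_eq ν hf hy Z).1,
      (integral_det_interlaces_eq ν hf hy Z).2, Set.indicator_of_mem hy,
      vandermondeTimesDet_truncationTransform, mul_assoc, ← ENNReal.ofReal_mul]
    · congr 2
      ring
    · exact mul_nonneg (Finset.prod_nonneg fun k _ => pow_nonneg (hy.2 k).le _)
        (vandermonde_pos hy.1).le
    · filter_upwards [ae_restrict_mem (measurableSet_interlaces_right y)] with x hx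
      exact mul_det_inv_pow_nonneg ν hpos (Interlaces.right_mem_chamber hx)
  · simp [Set.indicator_of_notMem hy, fun x => hJ0 x y fun h => hy h.left_mem_chamber]

end

/-! ### Deleting one row of a unitarily invariant matrix -/

/-- A measure on matrices that is invariant under left multiplication by unitary matrices. -/
def IsLeftUnitaryInvariant {ι : Type*} [Fintype ι] [DecidableEq ι] {n : ℕ}
    (ρ : Measure (Matrix ι (Fin n) ℂ)) : Prop :=
  ∀ V : Matrix.unitaryGroup ι ℂ, ρ.map (fun B => (V : Matrix ι ι ℂ) * B) = ρ

theorem measurable_sqSingularValues {a n : ℕ} :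
    Measurable (sqSingularValues : Matrix (Fin a) (Fin n) ℂ → Fin n → ℝ) := by
  refine measurable_eigenvalues (fun B => Matrix.isHermitian_conjTranspose_mul_self B) ?_
  exact (by fun_prop : Continuous fun B : Matrix (Fin a) (Fin n) ℂ => Bᴴ * B).measurable

theorem measurable_submatrix_rows {ι κ : Type*} {n : ℕ} (e : κ → ι) :
    Measurable fun B : Matrix ι (Fin n) ℂ => B.submatrix e id :=
  measurable_pi_iff.mpr fun i => measurable_pi_apply (e i)

theorem measurable_matrix_mul_left {ι κ : Type*} [Fintype ι] [Countable κ] {n : ℕ}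
    (V : Matrix κ ι ℂ) :
    Measurable fun B : Matrix ι (Fin n) ℂ => V * B := by
  have : Countable ι := Finite.to_countable
  exact (by fun_prop : Continuous fun B : Matrix ι (Fin n) ℂ => V * B).measurable

theorem sqSingularValues_submatrix_castSucc {N n : ℕ} (B : Matrix (Fin (N + 1)) (Fin n) ℂ) :
    sqSingularValues (B.submatrix Fin.castSucc id)
      = (isHermitian_deflatedGram B (Pi.single (Fin.last N) 1)).eigenvalues :=
  eigenvalues_congr (deflatedGram_single_last B).symm _ _

theorem IsPolynomialEnsemble.integrableOn {Ω : Type*} [MeasurableSpace Ω] {P : Measure Ω} {n : ℕ}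
    {z : Ω → Fin n → ℝ} {f : Fin n → ℝ → ℝ} (h : IsPolynomialEnsemble P z f) (k : Fin n) :
    IntegrableOn (f k) (Set.Ioi 0) := by
  simpa using h.integrable_moments ⟨0, k.pos⟩ k

theorem IsPolynomialEnsemble.deleteLastRow {N n ν : ℕ} (hN : N = n + ν)
    {ρ : Measure (Matrix (Fin (N + 1)) (Fin n) ℂ)} [SFinite ρ] (hρ : IsLeftUnitaryInvariant ρ)
    {f : Fin n → ℝ → ℝ} (hf : IsPolynomialEnsemble ρ sqSingularValues f) :
    IsPolynomialEnsemble ρ (fun B => sqSingularValues (B.submatrix Fin.castSucc id))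
      (fun k => truncationTransform ν 0 (f k)) := by
  obtain ⟨Z, hZ, hpos, hd⟩ := hf.exists_density
  have hfi := hf.integrableOn
  refine ⟨fun j k => integrableOn_pow_mul_truncationTransform (hfi k)
    (hf.integrable_moments j k) ν, ?_⟩
  obtain ⟨c, hc0, hc1, hc⟩ := exists_lintegral_deflatedGram_single_eq n ν
  have e : Fin n ⊕ Fin (ν + 1) ≃ Fin (N + 1) :=
    finSumFinEquiv.trans (finCongr (by omega))
  set v := (volume : Measure (Fin (N + 1) → ℂ)) (normSqBall (Fin (N + 1))) with hv
  have hv0 : v ≠ 0 := volume_normSqBall_ne_zero _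
  have hv1 : v ≠ ⊤ := volume_normSqBall_ne_top _
  have hr1 : c / v ≠ ⊤ := ENNReal.div_ne_top hc1 hv0
  have hr0 : 0 < (c / v).toReal :=
    ENNReal.toReal_pos (ENNReal.div_ne_zero.mpr ⟨hc0, hv1⟩) hr1
  have hinv : (Z / (c / v).toReal)⁻¹ = (c / v).toReal * Z⁻¹ := by
    rw [inv_div, div_eq_mul_inv]
  have hsymm : ∀ (Z : ℝ) (f : Fin n → ℝ → ℝ) (σ : Equiv.Perm (Fin n)) (x : Fin n → ℝ),
      Z * vandermondeTimesDet f (x ∘ σ) = Z * vandermondeTimesDet f x := by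
    intro Z f σ x
    rw [vandermondeTimesDet_comp_perm]
  have hnn : ∀ y : Fin n → ℝ, (∀ j, 0 < y j) →
      0 ≤ Z⁻¹ * vandermondeTimesDet (fun k => truncationTransform ν 0 (f k)) y := fun y hy =>
    mul_vandermondeTimesDet_truncationTransform_nonneg ν hfi hpos hy
  -- The averaging identity carries the ball volume `v` on one side and the Dirichlet constant `c`
  -- on the other; their ratio goes into the new normalisation.
  refine ⟨Z / (c / v).toReal, div_ne_zero hZ hr0.ne', fun y hy => ?_, ?_⟩
  · rw [hinv, mul_assoc]
    exact mul_nonneg hr0.le (hnn y hy)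
  refine hasUnorderedDensity_of_lintegral_chamber (hsymm _ _) fun F hF hs => ?_
  have h1 := hc (Fin (N + 1)) e (Fin.last N) ρ hρ
    (hd.ae_exists_mem_chamber (hsymm _ _) measurable_sqSingularValues) F hF hs
  have h2 := hd.lintegral_symmetrize (hsymm _ _) (measurable_interlacingAverage ν hF)
  rw [lintegral_interlacingAverage ν hfi hpos hF] at h2
  have h3 : ∫⁻ B, symmetrize (interlacingAverage ν F)
      (Matrix.isHermitian_conjTranspose_mul_self B).eigenvalues ∂ρ = _ := h2
  rw [h3, ← hv] at h1
  simp_rw [sqSingularValues_submatrix_castSucc]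
  rw [← ENNReal.mul_right_inj hv0 hv1, h1, hinv]
  simp_rw [mul_assoc, ENNReal.ofReal_mul hr0.le, ENNReal.ofReal_toReal hr1, mul_left_comm (F _)]
  rw [lintegral_const_mul' _ _ hr1, mul_left_comm _ (c / v), ← mul_assoc v,
    ENNReal.mul_div_cancel hv0 hv1]

/-- A unitary `V` acting on the remaining rows is the restriction of the block unitary `V ⊕ 1`,
under which the full law is invariant. -/
theorem IsLeftUnitaryInvariant.map_submatrix_castSucc {N n : ℕ}
    {ρ : Measure (Matrix (Fin (N + 1)) (Fin n) ℂ)} (hρ : IsLeftUnitaryInvariant ρ) :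
    IsLeftUnitaryInvariant (ρ.map fun B => B.submatrix Fin.castSucc id) := by
  intro V
  let V' : Matrix (Fin N ⊕ Fin 1) (Fin N ⊕ Fin 1) ℂ := Matrix.fromBlocks V 0 0 1
  let W : Matrix (Fin (N + 1)) (Fin (N + 1)) ℂ :=
    V'.submatrix finSumFinEquiv.symm finSumFinEquiv.symm
  have hV : (V : Matrix (Fin N) (Fin N) ℂ) * (V : Matrix (Fin N) (Fin N) ℂ)ᴴ = 1 :=
    Matrix.mem_unitaryGroup_iff.mp V.2
  have hW : W ∈ Matrix.unitaryGroup (Fin (N + 1)) ℂ := by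
    rw [Matrix.mem_unitaryGroup_iff, Matrix.star_eq_conjTranspose, Matrix.conjTranspose_submatrix,
      Matrix.submatrix_mul_equiv, Matrix.fromBlocks_conjTranspose, Matrix.fromBlocks_multiply, hV]
    simp
  have hmul : ∀ B : Matrix (Fin (N + 1)) (Fin n) ℂ, (W * B).submatrix Fin.castSucc id
      = (V : Matrix (Fin N) (Fin N) ℂ) * B.submatrix Fin.castSucc id := by
    intro B
    ext i k
    have hi : finSumFinEquiv.symm i.castSucc = Sum.inl i := finSumFinEquiv_symm_apply_castAdd i
    have hj : ∀ j : Fin N, finSumFinEquiv.symm j.castSucc = Sum.inl j := fun j =>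
      finSumFinEquiv_symm_apply_castAdd j
    have hl : finSumFinEquiv.symm (Fin.last N) = Sum.inr (0 : Fin 1) :=
      finSumFinEquiv_symm_apply_natAdd (m := N) (0 : Fin 1)
    simp [Matrix.mul_apply, Fin.sum_univ_castSucc, W, V', hj, hl]
  conv_rhs => rw [← hρ ⟨W, hW⟩]
  rw [Measure.map_map (measurable_matrix_mul_left _) (measurable_submatrix_rows _),
    Measure.map_map (measurable_submatrix_rows _) (measurable_matrix_mul_left _)]
  congr 1
  funext B
  exact (hmul B).symm

theorem IsPolynomialEnsemble.map_iff {Ω Ω' : Type*} [MeasurableSpace Ω] [MeasurableSpace Ω']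
    {P : Measure Ω} {g : Ω → Ω'} (hg : Measurable g) {n : ℕ} {z : Ω' → Fin n → ℝ}
    (hz : Measurable z) {f : Fin n → ℝ → ℝ} :
    IsPolynomialEnsemble (P.map g) z f ↔ IsPolynomialEnsemble P (fun ω => z (g ω)) f := by
  have h : ∀ p, HasUnorderedDensity (P.map g) z p ↔ HasUnorderedDensity P (fun ω => z (g ω)) p := by
    intro p
    refine forall_congr' fun F => forall_congr' fun hF => forall_congr' fun _ => ?_
    rw [lintegral_map (f := fun ω => F (z ω)) (hF.comp hz) hg]
  exact ⟨fun ⟨h1, Z, h2, h3, h4⟩ => ⟨h1, Z, h2, h3, (h _).mp h4⟩,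
    fun ⟨h1, Z, h2, h3, h4⟩ => ⟨h1, Z, h2, h3, (h _).mpr h4⟩⟩

/-- The determinant scales by `c^n`, absorbed into `Z`. The relation is required only on `(0,∞)`, so
this also serves to exchange functions that agree there. -/
theorem IsPolynomialEnsemble.const_mul {Ω : Type*} [MeasurableSpace Ω] {P : Measure Ω} {n : ℕ}
    {z : Ω → Fin n → ℝ} {f f' : Fin n → ℝ → ℝ} (h : IsPolynomialEnsemble P z f) {c : ℝ}
    (hc : c ≠ 0) (hff : ∀ k y, 0 < y → f' k y = c * f k y) : IsPolynomialEnsemble P z f' := by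
  obtain ⟨h1, Z, hZ, hpos, hd⟩ := h
  have hV : ∀ x : Fin n → ℝ, (∀ j, 0 < x j) →
      (c ^ n * Z)⁻¹ * vandermondeTimesDet f' x = Z⁻¹ * vandermondeTimesDet f x := by
    intro x hx
    have : (Matrix.of fun j k : Fin n => f' k (x j))
        = c • Matrix.of fun j k : Fin n => f k (x j) := by
      ext j k
      exact hff k (x j) (hx j)
    rw [vandermondeTimesDet, vandermondeTimesDet, this, Matrix.det_smul, Fintype.card_fin]
    field_simp
  refine ⟨fun j k => ?_, c ^ n * Z, mul_ne_zero (pow_ne_zero _ hc) hZ, fun x hx => ?_, ?_⟩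
  · refine ((h1 j k).const_mul c).congr ?_
    filter_upwards [ae_restrict_mem measurableSet_Ioi] with y hy
    rw [hff k y hy]
    ring
  · rw [hV x hx]
    exact hpos x hx
  · intro F hF hs
    rw [hd F hF hs]
    refine setLIntegral_congr_fun (measurableSet_pos n) fun x hx => ?_
    simp only [hV x hx]

/-! ### Composition of transforms and the substitution to `(0,1)` -/

theorem integrableOn_truncationTransform_integrand {f : ℝ → ℝ} (hf : IntegrableOn f (Set.Ioi 0))
    (ν p : ℕ) {y : ℝ} (hy : 0 < y) :
    IntegrableOn (fun t => (t - y) ^ p * (t ^ (ν + p + 1))⁻¹ * f t) (Set.Ioi y) := by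
  refine (hf.mono_set (Set.Ioi_subset_Ioi hy.le)).bdd_mul (c := (y ^ (ν + 1))⁻¹)
    (by fun_prop) ?_
  filter_upwards [ae_restrict_mem measurableSet_Ioi] with t ht
  have hyt : y < t := ht
  have ht0 := hy.trans hyt
  have hty : 0 ≤ t - y := (sub_pos.mpr hyt).le
  rw [Real.norm_of_nonneg (by positivity)]
  calc (t - y) ^ p * (t ^ (ν + p + 1))⁻¹ ≤ t ^ p * (t ^ (ν + p + 1))⁻¹ := by
        gcongr
        linarith
    _ = (t ^ (ν + 1))⁻¹ := by
        rw [add_right_comm, pow_add _ (ν + 1)]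
        field_simp
    _ ≤ (y ^ (ν + 1))⁻¹ := by gcongr

/-- The prefactor `t^(ν+p+1)` of the inner transform cancels the outer weight. After Fubini only the
integral of `(t - y)^p` over `(y, s)` remains, which equals `(s - y)^(p+1) / (p + 1)`. -/
theorem truncationTransform_comp {f : ℝ → ℝ} (hf : IntegrableOn f (Set.Ioi 0)) (ν p : ℕ) {y : ℝ}
    (hy : 0 < y) :
    truncationTransform ν p (truncationTransform (ν + p + 1) 0 f) y
      = ((p : ℝ) + 1)⁻¹ * truncationTransform ν (p + 1) f y := by
  let h : ℝ → ℝ := (Set.Ioi 0).indicator fun t => (t ^ (ν + p + 1 + 1))⁻¹ * f t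
  have hh : AEStronglyMeasurable h volume := by
    refine (aestronglyMeasurable_indicator_iff measurableSet_Ioi).mpr ?_
    exact AEStronglyMeasurable.mul (by fun_prop) hf.aestronglyMeasurable
  let J : ℝ × ℝ → ℝ := {z : ℝ × ℝ | y < z.1 ∧ z.1 < z.2}.indicator
    fun z => (z.1 - y) ^ p * h z.2
  have hms : MeasurableSet {z : ℝ × ℝ | y < z.1 ∧ z.1 < z.2} :=
    (measurableSet_lt measurable_const measurable_fst).inter
      (measurableSet_lt measurable_fst measurable_snd)
  have hJm : AEStronglyMeasurable J (volume.prod volume) := by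
    refine AEStronglyMeasurable.indicator ?_ hms
    exact AEStronglyMeasurable.mul (by fun_prop) hh.comp_snd
  have hslice : ∀ s t, J (t, s) = (Set.Ioo y s).indicator (fun t => (t - y) ^ p * h s) t := by
    intro s t
    simp [J, Set.indicator_apply]
  have hnorm : ∀ s t, ‖J (t, s)‖ = (Set.Ioo y s).indicator (fun t => (t - y) ^ p * ‖h s‖) t := by
    intro s t
    by_cases ht : t ∈ Set.Ioo y s
    · have := (sub_pos.mpr ht.1).le
      rw [hslice, Set.indicator_of_mem ht, Set.indicator_of_mem ht, norm_mul,
        Real.norm_of_nonneg (by positivity)]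
    · rw [hslice, Set.indicator_of_notMem ht, Set.indicator_of_notMem ht, norm_zero]
  have hint : ∀ (s a : ℝ), ∫ t, (Set.Ioo y s).indicator (fun t => (t - y) ^ p * a) t
      = (Set.Ioi y).indicator (fun s => (s - y) ^ (p + 1) / (p + 1) * a) s := by
    intro s a
    rw [integral_indicator measurableSet_Ioo]
    by_cases hs : y < s
    · rw [Set.indicator_of_mem (by exact hs), integral_mul_const,
        ← integral_Ioc_eq_integral_Ioo, ← intervalIntegral.integral_of_le hs.le,
        intervalIntegral.integral_comp_sub_right (fun t => t ^ p), integral_pow]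
      simp
    · rw [Set.indicator_of_notMem (by exact hs), Set.Ioo_eq_empty hs]
      simp
  have hhs : ∀ s ∈ Set.Ioi y, h s = (s ^ (ν + p + 1 + 1))⁻¹ * f s := fun s hs =>
    Set.indicator_of_mem (show s ∈ Set.Ioi 0 from hy.trans hs) _
  have hJ : Integrable J (volume.prod volume) := by
    rw [integrable_prod_iff' hJm]
    constructor
    · refine Filter.Eventually.of_forall fun s => ?_
      simp_rw [hslice]
      rw [integrable_indicator_iff measurableSet_Ioo]
      exact ((by fun_prop : Continuous fun t : ℝ => (t - y) ^ p * h s).integrableOn_Icc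
        (a := y) (b := s)).mono_set Set.Ioo_subset_Icc_self
    · simp_rw [hnorm, hint]
      have : (fun s => (Set.Ioi y).indicator (fun s' => (s' - y) ^ (p + 1) / (p + 1) * ‖h s‖) s)
          = (Set.Ioi y).indicator fun s => (s - y) ^ (p + 1) / (p + 1) * ‖h s‖ := by
        ext s
        simp [Set.indicator_apply]
      rw [this, integrable_indicator_iff measurableSet_Ioi]
      refine ((integrableOn_truncationTransform_integrand hf ν (p + 1) hy).norm.div_const
        ((p : ℝ) + 1)).congr ?_
      filter_upwards [ae_restrict_mem measurableSet_Ioi] with s hs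
      have hys := (sub_pos.mpr (show y < s from hs)).le
      rw [hhs s hs, norm_mul, norm_mul, norm_mul, Real.norm_of_nonneg (pow_nonneg hys _),
        add_assoc ν p 1]
      ring
  have hswap := integral_integral_swap (f := fun t s => J (t, s)) hJ
  have hL : ∀ t, ∫ s, J (t, s) = (Set.Ioi y).indicator (fun t => (t - y) ^ p *
      (t ^ (ν + p + 1))⁻¹ * truncationTransform (ν + p + 1) 0 f t) t := by
    intro t
    by_cases ht : y < t
    · have ht0 := hy.trans ht
      rw [Set.indicator_of_mem (by exact ht), truncationTransform, ← mul_assoc,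
        mul_assoc _ _ (t ^ _), inv_mul_cancel₀ (by positivity), mul_one, ← integral_const_mul,
        ← integral_indicator measurableSet_Ioi]
      congr 1
      ext s
      by_cases hs : t < s
      · have hs0 := ht0.trans hs
        simp [J, h, Set.indicator_apply, ht, hs, hs0]
      · simp [J, hs]
    · rw [Set.indicator_of_notMem (by exact ht)]
      simp [J, ht]
  have hR : ∀ s, ∫ t, J (t, s) = (Set.Ioi y).indicator (fun s => ((p : ℝ) + 1)⁻¹ *
      ((s - y) ^ (p + 1) * (s ^ (ν + (p + 1) + 1))⁻¹ * f s)) s := by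
    intro s
    simp_rw [hslice]
    rw [hint]
    by_cases hs : s ∈ Set.Ioi y
    · rw [Set.indicator_of_mem hs, Set.indicator_of_mem hs, hhs s hs, add_assoc ν p 1]
      ring
    · rw [Set.indicator_of_notMem hs, Set.indicator_of_notMem hs]
  simp_rw [hL, hR] at hswap
  rw [integral_indicator measurableSet_Ioi, integral_indicator measurableSet_Ioi,
    integral_const_mul] at hswap
  rw [truncationTransform, hswap, truncationTransform]
  ring

theorem image_div_Ioi {y : ℝ} (hy : 0 < y) : (fun t => y / t) '' Set.Ioi y = Set.Ioo 0 1 := by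
  ext x
  constructor
  · rintro ⟨t, ht, rfl⟩
    have ht0 : 0 < t := hy.trans ht
    exact ⟨div_pos hy ht0, (div_lt_one ht0).mpr ht⟩
  · intro hx
    refine ⟨y / x, ?_, ?_⟩
    · rw [Set.mem_Ioi, lt_div_iff₀ hx.1]
      exact mul_lt_of_lt_one_right hy hx.2
    · have := hx.1.ne'
      field_simp

/-- Substitute `x = y / t`, which maps `(y,∞)` bijectively onto `(0,1)`. -/
theorem integral_Ioo_eq_truncationTransform {f : ℝ → ℝ} (hf : IntegrableOn f (Set.Ioi 0)) (ν p : ℕ)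
    {y : ℝ} (hy : 0 < y) :
    IntegrableOn (fun x : ℝ => x ^ ν * (1 - x) ^ p * f (y / x) * (1 / x)) (Set.Ioo 0 1) ∧
    ∫ x in Set.Ioo (0 : ℝ) 1, x ^ ν * (1 - x) ^ p * f (y / x) * (1 / x)
      = truncationTransform ν p f y := by
  have hderiv : ∀ t ∈ Set.Ioi y, HasDerivWithinAt (fun t => y / t) (-y / t ^ 2) (Set.Ioi y) t := by
    intro t ht
    have ht0 : t ≠ 0 := (hy.trans ht).ne'
    have := (hasDerivAt_inv ht0).const_mul y
    refine (this.congr_deriv ?_).hasDerivWithinAt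
    ring
  have hinj : Set.InjOn (fun t => y / t) (Set.Ioi y) := by
    intro a ha b hb hab
    have ha0 : a ≠ 0 := (hy.trans ha).ne'
    have hb0 : b ≠ 0 := (hy.trans hb).ne'
    simp only at hab
    rw [div_eq_div_iff ha0 hb0] at hab
    exact (mul_left_cancel₀ hy.ne' hab).symm
  have heq : ∀ t ∈ Set.Ioi y, |-y / t ^ 2| • ((y / t) ^ ν * (1 - y / t) ^ p * f (y / (y / t)) *
      (1 / (y / t))) = y ^ ν * ((t - y) ^ p * (t ^ (ν + p + 1))⁻¹ * f t) := by
    intro t ht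
    have ht0 : 0 < t := hy.trans ht
    have h1 : y / (y / t) = t := by field_simp
    have h2 : 1 - y / t = (t - y) / t := by field_simp
    have h3 : |-y / t ^ 2| = y / t ^ 2 := by
      rw [abs_div, abs_neg, abs_of_pos hy, abs_of_pos (by positivity)]
    rw [h1, h2, h3, smul_eq_mul, div_pow, div_pow]
    field_simp
    ring
  have h1 := integrableOn_image_iff_integrableOn_abs_deriv_smul measurableSet_Ioi hderiv hinj
    (fun x : ℝ => x ^ ν * (1 - x) ^ p * f (y / x) * (1 / x))
  have h2 := integral_image_eq_integral_abs_deriv_smul measurableSet_Ioi hderiv hinj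
    (fun x : ℝ => x ^ ν * (1 - x) ^ p * f (y / x) * (1 / x))
  rw [image_div_Ioi hy] at h1 h2
  rw [h1, h2, integrableOn_congr_fun heq measurableSet_Ioi,
    setIntegral_congr_fun measurableSet_Ioi heq, integral_const_mul]
  exact ⟨(integrableOn_truncationTransform_integrand hf ν p hy).const_mul _, rfl⟩

/-! ### Deleting several rows, and the truncation of a Haar unitary -/

/-- Exponent `p` corresponds to deleting `p + 1` rows, so the base case is already a one-row
deletion. -/
theorem IsPolynomialEnsemble.deleteRows {n ν : ℕ} (p : ℕ) {N : ℕ} (hN : N = n + ν + p)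
    (hle : n + ν ≤ N + 1) {ρ : Measure (Matrix (Fin (N + 1)) (Fin n) ℂ)} [SFinite ρ]
    (hρ : IsLeftUnitaryInvariant ρ) {f : Fin n → ℝ → ℝ}
    (hf : IsPolynomialEnsemble ρ sqSingularValues f) :
    IsPolynomialEnsemble ρ (fun B => sqSingularValues (B.submatrix (Fin.castLE hle) id))
      (fun k => truncationTransform ν p (f k)) := by
  induction p generalizing N f with
  | zero =>
    subst hN
    exact hf.deleteLastRow rfl hρ
  | succ p ih =>
    obtain rfl : N = n + ν + p + 1 := hN
    -- The matrix now has `n + ν + p + 2` rows, so its last row goes with the exponent `ν + p + 1`,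
    -- the one that the composition formula expects.
    have h1 := hf.deleteLastRow (ν := ν + p + 1) (by omega) hρ
    rw [← IsPolynomialEnsemble.map_iff (measurable_submatrix_rows Fin.castSucc)
      measurable_sqSingularValues] at h1
    have h2 := ih rfl (by omega) hρ.map_submatrix_castSucc h1
    have h3 := (IsPolynomialEnsemble.map_iff (measurable_submatrix_rows Fin.castSucc)
      (measurable_sqSingularValues.comp (measurable_submatrix_rows _))).mp h2
    refine h3.const_mul (c := (p : ℝ) + 1) (by positivity) fun k y hy => ?_
    rw [truncationTransform_comp (hf.integrableOn k) ν p hy, ← mul_assoc,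
      mul_inv_cancel₀ (by positivity), one_mul]

/-- Reduces an arbitrary choice of rows to the first `a` ones, by extending the bijection between
the two ranges to a permutation. -/
theorem exists_perm_comp_castLE_eq {a m : ℕ} (h : a ≤ m) (rows : Fin a ↪ Fin m) :
    ∃ τ : Equiv.Perm (Fin m), ∀ i, τ (Fin.castLE h i) = rows i := by
  let e : Set.range (Fin.castLE h) ≃ Set.range rows :=
    (Equiv.ofInjective _ (Fin.castLE_injective h)).symm.trans (Equiv.ofInjective _ rows.injective)
  refine ⟨e.extendSubtype, fun i => ?_⟩
  rw [Equiv.extendSubtype_apply_of_mem e _ ⟨i, rfl⟩]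
  have : (Equiv.ofInjective _ (Fin.castLE_injective h)).symm ⟨Fin.castLE h i, i, rfl⟩ = i :=
    Equiv.ofInjective_symm_apply _ i
  simp [e, this]

section

variable {m l n : ℕ} {Ω : Type*} [MeasurableSpace Ω] {P : Measure Ω}
  {U : Ω → Matrix.unitaryGroup (Fin m) ℂ} {X : Ω → Matrix (Fin l) (Fin n) ℂ}

theorem measurable_unitary_submatrix_mul (τ : Fin m → Fin m) (cols : Fin l → Fin m) :
    Measurable fun z : Matrix (Fin l) (Fin n) ℂ × Matrix.unitaryGroup (Fin m) ℂ =>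
      (z.2 : Matrix (Fin m) (Fin m) ℂ).submatrix τ cols * z.1 := by
  have hcoe : Measurable fun z : Matrix (Fin l) (Fin n) ℂ × Matrix.unitaryGroup (Fin m) ℂ =>
      (z.2 : Matrix (Fin m) (Fin m) ℂ) := measurable_subtype_coe.comp measurable_snd
  refine measurable_pi_iff.mpr fun i => measurable_pi_iff.mpr fun k => ?_
  simp only [Matrix.mul_apply, Matrix.submatrix_apply]
  refine Finset.measurable_fun_sum _ fun j _ => Measurable.mul ?_ ?_
  · exact measurable_pi_iff.mp (measurable_pi_iff.mp hcoe (τ i)) (cols j)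
  · exact measurable_pi_iff.mp (measurable_pi_iff.mp measurable_fst j) k

theorem Measurable.unitary_submatrix_mul (hU : Measurable U) (hX : Measurable X)
    (τ : Fin m → Fin m) (cols : Fin l → Fin m) :
    Measurable fun ω => (U ω : Matrix (Fin m) (Fin m) ℂ).submatrix τ cols * X ω := by
  have h := measurable_unitary_submatrix_mul (n := n) τ cols
  generalize hΦ : (fun z : Matrix (Fin l) (Fin n) ℂ × Matrix.unitaryGroup (Fin m) ℂ =>
      (z.2 : Matrix (Fin m) (Fin m) ℂ).submatrix τ cols * z.1) = Φ at h
  have h' : Measurable fun ω => Φ (X ω, U ω) := h.comp (hX.prodMk hU)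
  subst hΦ
  exact h'

/-- Multiplying the row-permuted matrix by `V` amounts to multiplying `U` by the conjugate of `V`
under `τ`; this preserves the Haar law and the independence from `X`, hence the joint law. -/
theorem isLeftUnitaryInvariant_map_submatrix_mul [IsProbabilityMeasure P] (hU : Measurable U)
    (hHaar : (P.map U).IsHaarMeasure) (hX : Measurable X) (hindep : IndepFun X U P)
    (τ : Equiv.Perm (Fin m)) (cols : Fin l → Fin m) :
    IsLeftUnitaryInvariant
      (P.map fun ω => (U ω : Matrix (Fin m) (Fin m) ℂ).submatrix τ cols * X ω) := by
  intro V
  let V' : Matrix.unitaryGroup (Fin m) ℂ :=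
    ⟨(V : Matrix (Fin m) (Fin m) ℂ).submatrix τ.symm τ.symm, by
      rw [Matrix.mem_unitaryGroup_iff, Matrix.star_eq_conjTranspose, Matrix.conjTranspose_submatrix,
        Matrix.submatrix_mul_equiv, ← Matrix.star_eq_conjTranspose,
        Matrix.mem_unitaryGroup_iff.mp V.2, Matrix.submatrix_one_equiv]⟩
  have hV' : Measurable fun W : Matrix.unitaryGroup (Fin m) ℂ => V' * W := by
    have h : Measurable fun W : Matrix.unitaryGroup (Fin m) ℂ =>
        (V' : Matrix (Fin m) (Fin m) ℂ) * (W : Matrix (Fin m) (Fin m) ℂ) :=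
      (measurable_matrix_mul_left _).comp measurable_subtype_coe
    exact h.subtype_mk (h := fun W => (V' * W).2)
  let Φ : Matrix (Fin l) (Fin n) ℂ × Matrix.unitaryGroup (Fin m) ℂ → Matrix (Fin m) (Fin n) ℂ :=
    fun z => (z.2 : Matrix (Fin m) (Fin m) ℂ).submatrix τ cols * z.1
  have hΦ : Measurable Φ := measurable_unitary_submatrix_mul τ cols
  have hmul : ∀ z, (V : Matrix (Fin m) (Fin m) ℂ) * Φ z = Φ (z.1, V' * z.2) := by
    intro z
    have : ((V' * z.2 : Matrix.unitaryGroup (Fin m) ℂ) : Matrix (Fin m) (Fin m) ℂ).submatrix τ cols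
        = (V : Matrix (Fin m) (Fin m) ℂ)
          * (z.2 : Matrix (Fin m) (Fin m) ℂ).submatrix τ cols := by
      ext i j
      simp only [V', Matrix.UnitaryGroup.mul_val, Matrix.submatrix_apply, Matrix.mul_apply]
      rw [← Equiv.sum_comp τ]
      simp
    simp only [Φ]
    rw [this, Matrix.mul_assoc]
  have hprob : IsProbabilityMeasure (P.map U) := Measure.isProbabilityMeasure_map hU.aemeasurable
  have hlaw : P.map (fun ω => (X ω, U ω)) = P.map (fun ω => (X ω, V' * U ω)) := by
    rw [(indepFun_iff_map_prod_eq_prod_map_map hX.aemeasurable hU.aemeasurable).mp hindep,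
      (indepFun_iff_map_prod_eq_prod_map_map (g := fun ω => V' * U ω) hX.aemeasurable
        (hV'.comp hU).aemeasurable).mp (hindep.comp measurable_id hV')]
    congr 1
    have : P.map (fun ω => V' * U ω) = (P.map U).map (V' * ·) := (Measure.map_map hV' hU).symm
    rw [this, map_mul_left_eq_self]
  have h2 : Measurable fun ω => Φ (X ω, U ω) := hΦ.comp (hX.prodMk hU)
  have h1 : P.map (fun ω => Φ (X ω, U ω))
      = (P.map fun ω => (X ω, U ω)).map Φ := (Measure.map_map hΦ (hX.prodMk hU)).symm
  change (P.map fun ω => Φ (X ω, U ω)).map _ = P.map fun ω => Φ (X ω, U ω)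
  have h3 : Measurable fun ω => (X ω, V' * U ω) := hX.prodMk (hV'.comp hU)
  rw [Measure.map_map (measurable_matrix_mul_left _) h2, h1, hlaw, Measure.map_map hΦ h3]
  congr 1
  funext ω
  exact hmul (X ω, U ω)

end

/-- With all rows kept, the selected columns of a unitary are orthonormal, so the Gram matrix of the
product is that of `X`. -/
theorem sqSingularValues_unitary_submatrix_mul {m l n : ℕ} (W : Matrix.unitaryGroup (Fin m) ℂ)
    (τ : Equiv.Perm (Fin m)) (cols : Fin l ↪ Fin m) (X : Matrix (Fin l) (Fin n) ℂ) :
    sqSingularValues ((W : Matrix (Fin m) (Fin m) ℂ).submatrix τ cols * X)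
      = sqSingularValues X := by
  have hW : (W : Matrix (Fin m) (Fin m) ℂ)ᴴ * W = 1 := Matrix.UnitaryGroup.star_mul_self W
  have h : ((W : Matrix (Fin m) (Fin m) ℂ).submatrix τ cols)ᴴ
      * (W : Matrix (Fin m) (Fin m) ℂ).submatrix τ cols = 1 := by
    rw [Matrix.conjTranspose_submatrix, Matrix.submatrix_mul_equiv, hW,
      Matrix.submatrix_one_embedding]
  refine eigenvalues_congr ?_ _ _
  rw [Matrix.conjTranspose_mul, Matrix.mul_assoc, ← Matrix.mul_assoc _ _ X, h, Matrix.one_mul]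

theorem theorem2p2 (n m l ν : ℕ) (hnl : n ≤ l) (hlm : l ≤ m) (hm : n + ν + 1 ≤ m)
    {Ω : Type*} [MeasurableSpace Ω] (P : Measure Ω) [IsProbabilityMeasure P]
    (U : Ω → Matrix.unitaryGroup (Fin m) ℂ) (hU : Measurable U)
    (hHaar : (P.map U).IsHaarMeasure)
    (rows : Fin (n + ν) ↪ Fin m) (cols : Fin l ↪ Fin m)
    (T : Ω → Matrix (Fin (n + ν)) (Fin l) ℂ)
    (hT : ∀ ω, T ω = (U ω : Matrix (Fin m) (Fin m) ℂ).submatrix rows cols)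
    (X : Ω → Matrix (Fin l) (Fin n) ℂ) (hX : Measurable X)
    (hindep : IndepFun X U P)
    (f : Fin n → ℝ → ℝ)
    (hf : IsPolynomialEnsemble P (fun ω => sqSingularValues (X ω)) f) :
    (∀ k : Fin n, ∀ y : ℝ, 0 < y →
      IntegrableOn (fun x : ℝ => x ^ ν * (1 - x) ^ (m - n - ν - 1) * f k (y / x) * (1 / x))
        (Set.Ioo 0 1)) ∧
    IsPolynomialEnsemble P (fun ω => sqSingularValues (T ω * X ω))
      (fun (k : Fin n) (y : ℝ) =>
        ∫ x in Set.Ioo (0 : ℝ) 1,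
          x ^ ν * (1 - x) ^ (m - n - ν - 1) * f k (y / x) * (1 / x)) := by
  refine ⟨fun k y hy => (integral_Ioo_eq_truncationTransform (hf.integrableOn k) ν _ hy).1, ?_⟩
  -- Passing from `m` rows to `n + ν` deletes `p + 1` of them, so `p` is the exponent `m - n - ν -
  -- 1`.
  obtain ⟨p, rfl⟩ : ∃ p, m = n + ν + p + 1 := ⟨m - (n + ν + 1), by omega⟩
  have hp : n + ν + p + 1 - n - ν - 1 = p := by omega
  rw [hp]
  have hle : n + ν ≤ n + ν + p + 1 := by omega
  obtain ⟨τ, hτ⟩ := exists_perm_comp_castLE_eq hle rows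
  have hB : Measurable fun ω => (U ω : Matrix _ _ ℂ).submatrix τ cols * X ω :=
    hU.unitary_submatrix_mul hX τ cols
  have hinv := isLeftUnitaryInvariant_map_submatrix_mul hU hHaar hX hindep τ cols
  have hens : IsPolynomialEnsemble (P.map fun ω => (U ω : Matrix _ _ ℂ).submatrix τ cols * X ω)
      sqSingularValues f := by
    rw [IsPolynomialEnsemble.map_iff hB measurable_sqSingularValues]
    simpa only [sqSingularValues_unitary_submatrix_mul] using hf
  have h1 := (IsPolynomialEnsemble.map_iff hB (measurable_sqSingularValues.comp
    (measurable_submatrix_rows (Fin.castLE hle)))).mp (hens.deleteRows p rfl hle hinv)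
  have hTX : ∀ ω, ((U ω : Matrix _ _ ℂ).submatrix τ cols * X ω).submatrix (Fin.castLE hle) id
      = T ω * X ω := by
    intro ω
    ext i k
    simp [hT, Matrix.mul_apply, hτ]
  simp only [Function.comp_apply, hTX] at h1
  exact h1.const_mul one_ne_zero fun k y hy => by
    rw [one_mul]
    exact (integral_Ioo_eq_truncationTransform (hf.integrableOn k) ν p hy).2
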